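/- Let $k$ be a field, let $\Gamma$ be a subgroup of $(k^*)^2$ with $\Gamma\neq\{(1,1)\}$, let $R$ be a commutative $k$-algebra, and let $\mathfrak p$ be a maximal ideal of $R$ with $\kappa:=R/\mathfrak p$. Let $M_\Gamma$ be the group of all $(i_1,i_2)\in\mathbb Z^2$ such that $a_1^{i_1}a_2^{i_2}=1$ for all $(a_1,a_2)\in\Gamma$, and let $\gamma_1,\gamma_2$ be the images of the coordinate unit vectors of $\mathbb Z^2$ in $\mathbb Z^2/M_\Gamma$. For a commutative ring $S$ and $\gamma\in\mathbb Z^2/M_\Gamma$, let $S[x_1,x_2]_\gamma$ be the $S$-submodule of $S[x_1,x_2]$ generated by the monomials $x_1^{i_1}x_2^{i_2}$ for which the image of $(i_1,i_2)$ in $\mathbb Z^2/M_\Gamma$ equals $\gamma$; a polynomial is called $\Gamma$-homogeneous if it belongs to $S[x_1,x_2]_\gamma$ for some $\gamma$. Let $C_\Gamma(R)$ be the set of automorphisms $\phi$ of the $R$-algebra $R[x_1,x_2]$ such that $\phi(x_i)\in R[x_1,x_2]_{\gamma_i}$ for $i=1,2$; such a $\phi$ is identified with the pair $(\phi(x_1),\phi(x_2))$.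 Let $h\in\kappa[x_1,x_2]$ be a coordinate, that is, $\kappa[h,g]=\kappa[x_1,x_2]$ for some $g\in\kappa[x_1,x_2]$. If $h$ is $\Gamma$-homogeneous, then there exist $(g_1,g_2)\in C_\Gamma(R)$, $a\in\kappa^*$ and $i\in\{1,2\}$ such that $$\det\left(\frac{\partial g_l}{\partial x_j}\right)_{l,j}=1\qquad\text{and}\qquad h=a\,\bar g_i,$$ where $\bar g_i$ denotes the image of $g_i$ in $\kappa[x_1,x_2]$. -/

import Mathlib

open MvPolynomial

namespace HomogeneousCoordinate

/-- `𝐚 ^ i = a₁ ^ i₁ ⋯ aₙ ^ iₙ` for `𝐚 ∈ (kˣ)ⁿ` and `i ∈ ℤⁿ`. -/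
def multiPow {k : Type*} [Field k] {n : ℕ} (a : Fin n → kˣ) (i : Fin n → ℤ) : kˣ :=
  ∏ j, a j ^ i j

/-- `M_Γ`: the subgroup of all `i ∈ ℤⁿ` such that `𝐚 ^ i = 1` for all `𝐚 ∈ Γ`. -/
def relationLattice {k : Type*} [Field k] {n : ℕ} (Γ : Subgroup (Fin n → kˣ)) :
    AddSubgroup (Fin n → ℤ) where
  carrier := {i | ∀ a ∈ Γ, multiPow a i = 1}
  zero_mem' := by
    intro a _
    simp [multiPow]
  add_mem' := by
    intro i j hi hj a ha
    have h1 : (∏ l, a l ^ i l) = 1 := hi a ha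
    have h2 : (∏ l, a l ^ j l) = 1 := hj a ha
    simp [multiPow, zpow_add, Finset.prod_mul_distrib, h1, h2]
  neg_mem' := by
    intro i hi a ha
    have h1 : (∏ l, a l ^ i l) = 1 := hi a ha
    simp [multiPow, h1]

/-- The grading group `ℤⁿ / M_Γ`. -/
abbrev GradingGroup {k : Type*} [Field k] {n : ℕ} (Γ : Subgroup (Fin n → kˣ)) : Type :=
  (Fin n → ℤ) ⧸ relationLattice Γ

/-- `γ_i`: the image of the `i`-th coordinate unit vector of `ℤⁿ` in `ℤⁿ / M_Γ`. -/
def gen {k : Type*} [Field k] {n : ℕ} (Γ : Subgroup (Fin n → kˣ)) (i : Fin n) :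
    GradingGroup Γ :=
  QuotientAddGroup.mk (Pi.single i 1)

/-- `R[x]_γ`: the `R`-submodule of `R[x₁, …, xₙ]` generated by the monomials
`x₁ ^ i₁ ⋯ xₙ ^ iₙ` for which the image of `(i₁, …, iₙ)` in `ℤⁿ / M_Γ` is `γ`. -/
noncomputable def gradedPart {k : Type*} [Field k] {n : ℕ} (Γ : Subgroup (Fin n → kˣ))
    (R : Type*) [CommRing R] (γ : GradingGroup Γ) : Submodule R (MvPolynomial (Fin n) R) :=
  Submodule.span R
    {f | ∃ d : Fin n →₀ ℕ,
      (QuotientAddGroup.mk (fun j => (d j : ℤ)) : GradingGroup Γ) = γ ∧ f = monomial d 1}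

/-- `Γ`-homogeneous polynomials. -/
def IsHomogeneousPoly {k : Type*} [Field k] {n : ℕ} (Γ : Subgroup (Fin n → kˣ))
    {R : Type*} [CommRing R] (f : MvPolynomial (Fin n) R) : Prop :=
  ∃ γ : GradingGroup Γ, f ∈ gradedPart Γ R γ

/-- `C_Γ(R)`: the set of `Γ`-homogeneous automorphisms of the `R`-algebra `R[x₁, …, xₙ]`, that is,
the automorphisms `φ` with `φ(x_i) ∈ R[x]_{γ_i}` for all `i`. -/
def homogeneousAut {k : Type*} [Field k] {n : ℕ} (Γ : Subgroup (Fin n → kˣ))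
    (R : Type*) [CommRing R] : Set (MvPolynomial (Fin n) R ≃ₐ[R] MvPolynomial (Fin n) R) :=
  {φ | ∀ i, φ (X i) ∈ gradedPart Γ R (gen Γ i)}

/-- The Jacobian determinant `det (∂ f_i / ∂ x_j)`. -/
noncomputable def jacobianDet {n : ℕ} {R : Type*} [CommRing R]
    (f : Fin n → MvPolynomial (Fin n) R) : MvPolynomial (Fin n) R :=
  (Matrix.of fun i j => pderiv j (f i)).det

/-- `f` is a coordinate of `R[x₁, x₂]` if `R[f, g] = R[x₁, x₂]` for some `g`. -/
def IsCoordinate {R : Type*} [CommRing R] (f : MvPolynomial (Fin 2) R) : Prop :=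
  ∃ g : MvPolynomial (Fin 2) R, Algebra.adjoin R {f, g} = ⊤

end HomogeneousCoordinate

/-! Write `K` for the residue field. A coordinate `h` with partner `g` identifies `K[x, y]` with
`K[h][g]`, and the proof is a descent on the sum of the degrees in `g` of the two variables.

If one variable has degree 0, it lies in `K[h]`, and `h` is affine in it. Otherwise let `n, m > 0`
be the degrees and `P, Q` in `K[h]` the leading coefficients of `x, y`. Since `h` has degree 0 in
`g`, its leading form `f` for the weights `(n, m)` vanishes at `(P, Q)`. Hence `P ^ p = c Q ^ q`,
where `p = m / gcd` and `q = n / gcd`, and `x ^ p - c y ^ q` divides `f` (`exists_binomial_dvd`).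

To see that `p` or `q` is 1, deform `K[x, y]` by `g ↦ g + t`, which fixes `h`. For a suitable weight
of `t` the deformation has a nontrivial leading form `(U, V)`, and `f(U, V) = f(x, y)` is free of
`t`; hence so is its factor `U ^ p - c V ^ q`. A Jacobian estimate of `t`-degrees excludes this for
coprime `p, q ≥ 2` (`eq_X_of_binomial_eq`, `le_one_of_binomial_dvd`). So subtracting a multiple of a
power of one variable from the other lowers its degree (`exists_natDegree_sub_lt`).

Homogeneity of `h` makes it an eigenvector of the torus elements in `Γ`, which therefore preserve
the degree in `g`; this forces the step to be equivariant (`eq_pow_of_diagonal_eq`). Thus `h` arises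
from a multiple of a variable by homogeneous elementary automorphisms. These lift to `R` by lifting
one coefficient each, and have Jacobian determinant 1. -/

namespace HomogeneousCoordinate

/-! ### Homogeneous relations and binomial factors -/

/-- If a nontrivial homogeneous relation over `K` holds between `u` and `v`, then `u` is a scalar
multiple of `v`. -/
theorem exists_eq_C_mul_of_sum_eq_zero {K ι : Type*} [Field K] {u v : Polynomial K}
    (hv : v ≠ 0) (S : Finset ι) (hS : S.Nonempty) (c : ι → K) (hc : ∀ s ∈ S, c s ≠ 0)
    (l : ι → ℕ) (hl : Set.InjOn l S) (L : ℕ) (hL : ∀ s ∈ S, l s ≤ L)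
    (h : ∑ s ∈ S, Polynomial.C (c s) * u ^ l s * v ^ (L - l s) = 0) :
    ∃ a : K, u = Polynomial.C a * v := by
  classical
  let F := FractionRing (Polynomial K)
  let f := algebraMap (Polynomial K) F
  have hf : Function.Injective f := IsFractionRing.injective _ _
  have hfv : f v ≠ 0 := (map_ne_zero_iff f hf).2 hv
  -- Dividing the relation by `v ^ L` makes `u / v` a root of `r`, which is nonzero because the
  -- exponents `l s` are distinct.
  set r : Polynomial K := ∑ s ∈ S, Polynomial.monomial (l s) (c s) with hr
  have hr0 : r ≠ 0 := by
    obtain ⟨s, hs⟩ := hS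
    intro h0
    have h1 : r.coeff (l s) = c s := by
      rw [hr, Polynomial.finsetSum_coeff, Finset.sum_eq_single_of_mem s hs]
      · simp
      · intro b hb hbs
        rw [Polynomial.coeff_monomial, if_neg]
        exact fun h2 => hbs (hl hb hs h2)
    rw [h0] at h1
    exact hc s hs (by simpa using h1.symm)
  have hz : Polynomial.aeval (f u / f v) r = 0 := by
    have h2 : f v ^ L * Polynomial.aeval (f u / f v) r = 0 := by
      have h3 := congrArg f h
      rw [map_zero, map_sum] at h3
      rw [← h3, hr, map_sum, Finset.mul_sum]
      refine Finset.sum_congr rfl fun s hs => ?_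
      rw [Polynomial.aeval_monomial, map_mul, map_mul, map_pow, map_pow, div_pow]
      have h4 : f v ^ L = f v ^ (l s) * f v ^ (L - l s) := by
        rw [← pow_add, Nat.add_sub_cancel' (hL s hs)]
      have h5 : f (Polynomial.C (c s)) = algebraMap K F (c s) := by
        rw [IsScalarTower.algebraMap_apply K (Polynomial K) F]; rfl
      have h6 : ∀ {x y a b : F}, x ≠ 0 → x * y * (a * (b / x)) = a * b * y := by
        intro x y a b hx
        rw [mul_comm x y, mul_assoc, mul_left_comm x, mul_div_cancel₀ b hx, mul_comm]
      rw [h4, h5, h6 (pow_ne_zero _ hfv)]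
    exact (mul_eq_zero.1 h2).resolve_left (pow_ne_zero _ hfv)
  -- Being algebraic over `K`, the fraction is integral over `K[T]`, hence a polynomial `q`; then
  -- `r(q) = 0` leaves only constant `q`.
  have halg : IsAlgebraic K (f u / f v) := ⟨r, hr0, hz⟩
  have hint : IsIntegral (Polynomial K) (f u / f v) := halg.isIntegral.tower_top
  obtain ⟨q, hq⟩ := IsIntegrallyClosed.isIntegral_iff.1 hint
  have huq : u = q * v := by
    apply hf
    rw [map_mul]
    change f u = algebraMap _ F q * f v
    rw [hq, div_mul_cancel₀ _ hfv]
  have hcomp : r.comp q = 0 := by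
    apply hf
    rw [← hq, Polynomial.aeval_algebraMap_apply] at hz
    rw [map_zero, ← hz, Polynomial.comp_eq_aeval]
  rcases Polynomial.comp_eq_zero_iff.1 hcomp with h0 | ⟨-, h0⟩
  · exact absurd h0 hr0
  · exact ⟨_, by rw [huq]; congr 1⟩

/-- Modulo `a - c b`, a form of degree `L` in `a`, `b` is a multiple of `b ^ L`. -/
theorem sub_dvd_sum_sub {A ι : Type*} [CommRing A] (a b c : A) (S : Finset ι) (e : ι → A)
    (l : ι → ℕ) (L : ℕ) (hL : ∀ s ∈ S, l s ≤ L) :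
    a - c * b ∣ ∑ s ∈ S, e s * a ^ l s * b ^ (L - l s) - (∑ s ∈ S, e s * c ^ l s) * b ^ L := by
  rw [Finset.sum_mul, ← Finset.sum_sub_distrib]
  refine Finset.dvd_sum fun s hs => ?_
  have h1 : e s * a ^ l s * b ^ (L - l s) - e s * c ^ l s * b ^ L =
      (a ^ l s - (c * b) ^ l s) * (e s * b ^ (L - l s)) := by
    have h2 : b ^ L = b ^ l s * b ^ (L - l s) := by
      rw [← pow_add, Nat.add_sub_cancel' (hL s hs)]
    rw [h2, mul_pow]; ring
  rw [h1]
  exact Dvd.dvd.mul_right (sub_dvd_pow_sub_pow _ _ _) _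

/-- A weighted homogeneous polynomial vanishing at `(P, Q)` forces a binomial relation between
`P` and `Q`, and it is divisible by the binomial. -/
theorem exists_binomial_dvd {K : Type*} [Field K] {p q : ℕ} (hp : 0 < p) (hq : 0 < q)
    (hpq : p.Coprime q) {P Q : Polynomial K} (hP : P ≠ 0) (hQ : Q ≠ 0)
    {f : MvPolynomial (Fin 2) K} (hf : f ≠ 0) {W : ℕ}
    (hW : ∀ d ∈ f.support, q * d 0 + p * d 1 = W) (h0 : aeval ![P, Q] f = 0) :
    ∃ c : K, c ≠ 0 ∧ P ^ p = Polynomial.C c * Q ^ q ∧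
      (X 0 ^ p - C c * X 1 ^ q : MvPolynomial (Fin 2) K) ∣ f := by
  classical
  have hS : f.support.Nonempty := by simpa using hf
  obtain ⟨s₀, hs₀, hmin⟩ := Finset.exists_min_image f.support (fun d => d 0) hS
  set i₀ := s₀ 0
  set j₁ := s₀ 1
  set L := j₁ / q
  set j₀ := j₁ % q
  have hj : j₁ = q * L + j₀ := (Nat.div_add_mod _ _).symm
  let l : (Fin 2 →₀ ℕ) → ℕ := fun d => (d 0 - i₀) / p
  -- By coprimality the exponents on the line `q i + p j = W` differ by multiples of `(p, -q)`. So,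
  -- up to the monomial `x ^ i₀ y ^ j₀`, `f` is a form of degree `L` in `x ^ p` and `y ^ q`.
  have key : ∀ d ∈ f.support, d 0 = i₀ + p * l d ∧ l d ≤ L ∧ d 1 = j₀ + q * (L - l d) := by
    intro d hd
    have h1 := hW d hd
    have h2 := hW s₀ hs₀
    have h3 : i₀ ≤ d 0 := hmin d hd
    obtain ⟨t, ht⟩ := Nat.exists_eq_add_of_le h3
    have h4 : q * t + p * d 1 = p * j₁ := by
      have : q * (i₀ + t) + p * d 1 = q * i₀ + p * j₁ := by rw [← ht]; exact h1.trans h2.symm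
      nlinarith
    have h5 : p ∣ t := by
      have : p ∣ q * t := (Nat.dvd_add_left (Dvd.intro _ rfl)).1 (h4 ▸ Dvd.intro _ rfl)
      exact hpq.dvd_of_dvd_mul_left this
    obtain ⟨m, rfl⟩ := h5
    have h6 : l d = m := by
      change (d 0 - i₀) / p = m
      rw [ht, Nat.add_sub_cancel_left, Nat.mul_div_cancel_left _ hp]
    have h7 : q * m + d 1 = j₁ := by
      have : p * (q * m + d 1) = p * j₁ := by rw [← h4]; ring
      exact Nat.eq_of_mul_eq_mul_left hp this
    have h8 : m ≤ L := by
      rw [Nat.le_div_iff_mul_le hq]; nlinarith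
    rw [h6]
    refine ⟨ht, h8, ?_⟩
    obtain ⟨r, hr⟩ := Nat.exists_eq_add_of_le h8
    rw [hr, Nat.add_sub_cancel_left]
    rw [hj, hr] at h7
    nlinarith
  have hexp : ∀ {A : Type _} [CommRing A] [Algebra K A] (x y : A),
      aeval ![x, y] f = x ^ i₀ * y ^ j₀ *
        ∑ d ∈ f.support, algebraMap K A (f.coeff d) * (x ^ p) ^ l d * (y ^ q) ^ (L - l d) := by
    intro A _ _ x y
    rw [aeval_def, eval₂_eq', Finset.mul_sum]
    refine Finset.sum_congr rfl fun d hd => ?_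
    obtain ⟨h1, -, h2⟩ := key d hd
    rw [Fin.prod_univ_two]
    simp only [Matrix.cons_val_zero, Matrix.cons_val_one]
    rw [h1, h2, pow_add, pow_add, pow_mul, pow_mul]; ring
  have hinj : Set.InjOn l f.support := by
    intro d hd d' hd' hdd
    obtain ⟨h1, -, h2⟩ := key d hd
    obtain ⟨h1', -, h2'⟩ := key d' hd'
    ext i
    fin_cases i
    · change d 0 = d' 0
      rw [h1, h1', hdd]
    · change d 1 = d' 1
      rw [h2, h2', hdd]
  have hsum : ∑ d ∈ f.support,
      Polynomial.C (f.coeff d) * (P ^ p) ^ l d * (Q ^ q) ^ (L - l d) = 0 := by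
    have h1 := hexp P Q
    rw [h0] at h1
    exact (mul_eq_zero.1 h1.symm).resolve_left
      (mul_ne_zero (pow_ne_zero _ hP) (pow_ne_zero _ hQ))
  have hLl : ∀ d ∈ f.support, l d ≤ L := fun d hd => (key d hd).2.1
  obtain ⟨c, hc⟩ := exists_eq_C_mul_of_sum_eq_zero (pow_ne_zero q hQ) f.support hS
    (fun d => f.coeff d) (fun d hd => mem_support_iff.1 hd) l hinj L hLl hsum
  refine ⟨c, ?_, hc, ?_⟩
  · rintro rfl
    exact pow_ne_zero p hP (by simpa using hc)
  -- The congruence is used twice: at `(P ^ p, Q ^ q)` the divisor is 0, which shows that the form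
  -- vanishes at `(c, 1)`; at `(x ^ p, y ^ q)` this vanishing leaves the divisibility.
  · have h1 := sub_dvd_sum_sub (P ^ p) (Q ^ q) (Polynomial.C c) f.support
      (fun d => Polynomial.C (f.coeff d)) l L hLl
    rw [hsum, hc, sub_self, zero_dvd_iff, zero_sub, neg_eq_zero] at h1
    have h2 : ∑ d ∈ f.support, f.coeff d * c ^ l d = 0 := by
      have h3 := (mul_eq_zero.1 h1).resolve_right (pow_ne_zero _ (pow_ne_zero _ hQ))
      apply Polynomial.C_injective
      simpa using h3
    have h4 := sub_dvd_sum_sub (X 0 ^ p : MvPolynomial (Fin 2) K) (X 1 ^ q) (C c) f.support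
      (fun d => C (f.coeff d)) l L hLl
    have h5 : ∑ d ∈ f.support, (C (f.coeff d) * C c ^ l d : MvPolynomial (Fin 2) K) = 0 := by
      rw [← map_zero C, ← h2, map_sum]
      simp
    rw [h5, zero_mul, sub_zero] at h4
    have h6 : f = aeval ![X 0, X 1] f := by
      conv_lhs => rw [← aeval_X_left_apply (p := f)]
      congr 2
      funext i; fin_cases i <;> rfl
    rw [h6, hexp]
    exact Dvd.dvd.mul_left h4 _

/-! ### Rigidity of binomials under deformation -/

theorem pderiv_aeval {R σ τ : Type*} [CommRing R] [Fintype σ] (v : σ → MvPolynomial τ R)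
    (j : τ) (f : MvPolynomial σ R) :
    pderiv j (aeval v f) = ∑ l, aeval v (pderiv l f) * pderiv j (v l) := by
  classical
  induction f using MvPolynomial.induction_on with
  | C a => simp
  | add f g hf hg => simp only [map_add, hf, hg, add_mul, Finset.sum_add_distrib]
  | mul_X f i hf =>
    simp only [map_mul, aeval_X, pderiv_mul, hf, map_add, add_mul, Finset.sum_add_distrib,
      Finset.sum_mul]
    congr 1
    · exact Finset.sum_congr rfl fun l _ => by ring
    · rw [Finset.sum_eq_single i]
      · simp
      · intro b _ hb
        rw [pderiv_X_of_ne hb.symm]; simp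
      · simp

/-- Among the three variables `X 0` is the deformation parameter `t`, and `![0, X 1, X 2]`
specializes to `t = 0`. -/
theorem aeval_zero_eq_self {K : Type*} [CommRing K] {f : MvPolynomial (Fin 3) K}
    (hf : degreeOf 0 f = 0) : aeval ![0, X 1, X 2] f = f := by
  conv_rhs => rw [← aeval_X_left_apply (p := f)]
  rw [aeval_def, aeval_def, eval₂_eq', eval₂_eq']
  refine Finset.sum_congr rfl fun d hd => ?_
  have h0 : d 0 = 0 := Nat.le_zero.1 ((monomial_le_degreeOf 0 hd).trans hf.le)
  simp [Fin.prod_univ_three, h0]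

/-- A deformation of `(x, y)` over `K[x, y]` that preserves `x ^ p - c y ^ q`, with `p` and `q`
coprime and at least `2`, is trivial. -/
theorem eq_X_of_binomial_eq {K : Type*} [Field K] {p q : ℕ} (hp : 2 ≤ p) (hq : 2 ≤ q)
    (hpq : p.Coprime q) {c : K} (hc : c ≠ 0) {U V : MvPolynomial (Fin 3) K}
    (hU : aeval ![0, X 1, X 2] U = (X 1 : MvPolynomial (Fin 3) K))
    (hV : aeval ![0, X 1, X 2] V = (X 2 : MvPolynomial (Fin 3) K))
    (h : U ^ p - C c * V ^ q = X 1 ^ p - C c * X 2 ^ q) : U = X 1 ∧ V = X 2 := by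
  have hCc : (C c : MvPolynomial (Fin 3) K) ≠ 0 := by simpa using hc
  have hU0 : U ≠ 0 := by rintro rfl; exact X_ne_zero (R := K) 1 (by simpa using hU.symm)
  have hV0 : V ≠ 0 := by rintro rfl; exact X_ne_zero (R := K) 2 (by simpa using hV.symm)
  suffices hdeg : degreeOf 0 U = 0 ∧ degreeOf 0 V = 0 by
    rw [aeval_zero_eq_self hdeg.1] at hU
    rw [aeval_zero_eq_self hdeg.2] at hV
    exact ⟨hU, hV⟩
  have hd1 : C (p : K) * U ^ (p - 1) * pderiv 1 U -
      C c * (C (q : K) * V ^ (q - 1) * pderiv 1 V) = C (p : K) * X 1 ^ (p - 1) := by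
    have := congrArg (pderiv 1) h
    simpa [pderiv_pow, pderiv_mul, mul_assoc, pderiv_X_of_ne (show (2 : Fin 3) ≠ 1 by decide)] using this
  have hd2 : C (p : K) * U ^ (p - 1) * pderiv 2 U -
      C c * (C (q : K) * V ^ (q - 1) * pderiv 2 V) = - (C c * (C (q : K) * X 2 ^ (q - 1))) := by
    have := congrArg (pderiv 2) h
    simpa [pderiv_pow, pderiv_mul, mul_assoc, pderiv_X_of_ne (show (1 : Fin 3) ≠ 2 by decide)] using this
  set J := pderiv 1 U * pderiv 2 V - pderiv 2 U * pderiv 1 V with hJ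
  -- Specialization at `t = 0` commutes with the derivatives in `x` and `y`, and turns `J` into 1.
  have hJ0 : J ≠ 0 := by
    have hcomm : ∀ (j : Fin 3), j ≠ 0 → ∀ f : MvPolynomial (Fin 3) K,
        aeval (![0, X 1, X 2] : Fin 3 → MvPolynomial (Fin 3) K) (pderiv j f) =
          pderiv j (aeval ![0, X 1, X 2] f) := by
      intro j hj f
      rw [pderiv_aeval, Fin.sum_univ_three]
      fin_cases j
      · exact absurd rfl hj
      · simp [pderiv_X_of_ne (show (2 : Fin 3) ≠ 1 by decide)]
      · simp [pderiv_X_of_ne (show (1 : Fin 3) ≠ 2 by decide)]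
    intro h0
    have h1 := congrArg (aeval ![0, X 1, X 2] : _ →ₐ[K] MvPolynomial (Fin 3) K) h0
    rw [hJ, map_sub, map_mul, map_mul, hcomm 1 (by decide), hcomm 2 (by decide),
      hcomm 1 (by decide), hcomm 2 (by decide), hU, hV] at h1
    simp [pderiv_X_of_ne (show (2 : Fin 3) ≠ 1 by decide)] at h1
  have hdle : ∀ (j : Fin 3), j ≠ 0 → ∀ f : MvPolynomial (Fin 3) K,
      degreeOf 0 (pderiv j f) ≤ degreeOf 0 f := by
    intro j hj f
    rw [degreeOf_le_iff]
    intro d hd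
    rw [mem_support_iff, coeff_pderiv] at hd
    have h1 : d + Finsupp.single j 1 ∈ f.support := mem_support_iff.2 (left_ne_zero_of_mul hd)
    have h2 := monomial_le_degreeOf 0 h1
    simpa [hj] using h2
  have hX : ∀ j : Fin 3, j ≠ 0 → ∀ n : ℕ, degreeOf 0 (X j ^ n : MvPolynomial (Fin 3) K) = 0 := by
    intro j hj n
    rw [degreeOf_pow_eq _ _ _ (X_ne_zero j), degreeOf_X_of_ne hj.symm, mul_zero]
  have hbound : ∀ (a b : K) (i j l : Fin 3) (r s : ℕ) (W : MvPolynomial (Fin 3) K),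
      i ≠ 0 → j ≠ 0 → l ≠ 0 →
      degreeOf 0 (C a * X i ^ r * pderiv l W + C b * X j ^ s * pderiv i W) ≤ degreeOf 0 W := by
    intro a b i j l r s W hi hj hl
    refine (degreeOf_add_le _ _ _).trans (max_le ?_ ?_)
    · refine (degreeOf_mul_le _ _ _).trans ?_
      have h1 : degreeOf 0 (C a * X i ^ r : MvPolynomial (Fin 3) K) = 0 :=
        Nat.le_zero.1 ((degreeOf_C_mul_le _ _ _).trans (hX i hi r).le)
      rw [h1, zero_add]; exact hdle l hl W
    · refine (degreeOf_mul_le _ _ _).trans ?_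
      have h1 : degreeOf 0 (C b * X j ^ s : MvPolynomial (Fin 3) K) = 0 :=
        Nat.le_zero.1 ((degreeOf_C_mul_le _ _ _).trans (hX j hj s).le)
      rw [h1, zero_add]; exact hdle i hi W
  have hdegle : ∀ (a : K) (n : ℕ) (W : MvPolynomial (Fin 3) K), a ≠ 0 → W ≠ 0 →
      n * degreeOf 0 W ≤ degreeOf 0 (C a * (W ^ n * J)) := by
    intro a n W ha hW
    rw [degreeOf_C_mul _ _ (mem_nonZeroDivisors_of_ne_zero ha),
      degreeOf_mul_eq (pow_ne_zero _ hW) hJ0, degreeOf_pow_eq _ _ _ hW]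
    exact Nat.le_add_right _ _
  -- Cramer's rule for `hd1`, `hd2` expresses `p U ^ (p - 1) J` linearly in the derivatives of `V`,
  -- with coefficients free of `t`.
  have hA : (p : K) ≠ 0 → (p - 1) * degreeOf 0 U ≤ degreeOf 0 V := by
    intro hp0
    refine (hdegle p (p - 1) U hp0 hU0).trans ?_
    have h1 : C (p : K) * (U ^ (p - 1) * J) = C (p : K) * X 1 ^ (p - 1) * pderiv 2 V +
        C (c * q) * X 2 ^ (q - 1) * pderiv 1 V := by
      rw [hJ, C_mul]
      linear_combination pderiv 2 V * hd1 - pderiv 1 V * hd2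
    rw [h1]
    exact hbound _ _ 1 2 2 _ _ V (by decide) (by decide) (by decide)
  have hB : (q : K) ≠ 0 → (q - 1) * degreeOf 0 V ≤ degreeOf 0 U := by
    intro hq0
    refine (hdegle (c * q) (q - 1) V (mul_ne_zero hc hq0) hV0).trans ?_
    have h1 : C (c * q) * (V ^ (q - 1) * J) = C (p : K) * X 1 ^ (p - 1) * pderiv 2 U +
        C (c * q) * X 2 ^ (q - 1) * pderiv 1 U := by
      rw [hJ, C_mul]
      linear_combination pderiv 2 U * hd1 - pderiv 1 U * hd2
    rw [h1]
    exact hbound _ _ 1 2 2 _ _ U (by decide) (by decide) (by decide)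
  have hzero : ∀ (r : ℕ) (i : Fin 3) (W W' : MvPolynomial (Fin 3) K), 2 ≤ r → i ≠ 0 →
      W ^ (r - 1) * W' = X i ^ (r - 1) → degreeOf 0 W = 0 := by
    intro r i W W' hr hi hW
    have hne : W ^ (r - 1) * W' ≠ 0 := by rw [hW]; exact pow_ne_zero _ (X_ne_zero i)
    have h1 := congrArg (degreeOf 0) hW
    rw [hX i hi, degreeOf_mul_eq (left_ne_zero_of_mul hne) (right_ne_zero_of_mul hne)] at h1
    have h2 : W ≠ 0 := by
      rintro rfl
      rw [zero_pow (by omega), zero_mul] at hne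
      exact hne rfl
    rw [degreeOf_pow_eq _ _ _ h2] at h1
    rcases Nat.mul_eq_zero.1 (Nat.eq_zero_of_add_eq_zero_right h1) with h3 | h3
    · omega
    · exact h3
  have hpow : ∀ (r : ℕ) (i : Fin 3) (W : MvPolynomial (Fin 3) K), 2 ≤ r → i ≠ 0 →
      W ^ r = X i ^ r → degreeOf 0 W = 0 := by
    intro r i W hr hi hW
    refine hzero (r + 1) i W 1 (by omega) hi ?_
    simpa using hW
  -- If the characteristic divides `p`, it does not divide `q`. The `y`-derivative then reads `V ^
  -- (q - 1) * ∂V/∂y = y ^ (q - 1)`, so `V` is free of `t`, and `U ^ p = x ^ p` settles `U`. The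
  -- case of `q` is symmetric.
  by_cases hp0 : (p : K) = 0
  · have hq0 : (q : K) ≠ 0 := by
      intro hq0
      have h1 := hpq.cast (R := K)
      rw [hp0, hq0] at h1
      simp at h1
    have hCq : (C c * C (q : K) : MvPolynomial (Fin 3) K) ≠ 0 := by
      exact mul_ne_zero hCc ((map_ne_zero_iff C (C_injective _ _)).2 hq0)
    rw [hp0, C_0] at hd2
    have hVz : degreeOf 0 V = 0 := by
      refine hzero q 2 V (pderiv 2 V) hq (by decide) (mul_left_cancel₀ hCq ?_)
      linear_combination -hd2
    have hVX : V = X 2 := by rwa [aeval_zero_eq_self hVz] at hV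
    refine ⟨hpow p 1 U hp (by decide) ?_, hVz⟩
    rw [hVX] at h
    exact sub_left_injective h
  by_cases hq0 : (q : K) = 0
  · have hCp : (C (p : K) : MvPolynomial (Fin 3) K) ≠ 0 :=
      (map_ne_zero_iff C (C_injective _ _)).2 hp0
    rw [hq0, C_0] at hd1
    have hUz : degreeOf 0 U = 0 := by
      refine hzero p 1 U (pderiv 1 U) hp (by decide) (mul_left_cancel₀ hCp ?_)
      linear_combination hd1
    have hUX : U = X 1 := by rwa [aeval_zero_eq_self hUz] at hU
    refine ⟨hUz, hpow q 2 V hq (by decide) (mul_left_cancel₀ hCc ?_)⟩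
    rw [hUX] at h
    exact sub_right_injective h
  have hA := hA hp0
  have hB := hB hq0
  obtain ⟨r, rfl⟩ := Nat.exists_eq_add_of_le hp
  obtain ⟨s, rfl⟩ := Nat.exists_eq_add_of_le hq
  -- Coprime exponents cannot both be 2, so one of the two degree inequalities is strict unless the
  -- degrees vanish.
  have hrs : r ≠ 0 ∨ s ≠ 0 := by
    by_contra! h0
    rw [h0.1, h0.2] at hpq
    exact absurd hpq (by decide)
  rw [show 2 + r - 1 = r + 1 by omega, add_mul, one_mul] at hA
  rw [show 2 + s - 1 = s + 1 by omega, add_mul, one_mul] at hB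
  have h1 : r * degreeOf 0 U = 0 := by omega
  have h2 : s * degreeOf 0 V = 0 := by omega
  rcases hrs with h0 | h0
  · have := (Nat.mul_eq_zero.1 h1).resolve_left h0
    omega
  · have := (Nat.mul_eq_zero.1 h2).resolve_left h0
    omega

/-! ### Weighted leading forms -/

/-- `F` is the weighted homogeneous part of `f` of degree `d`, and all other monomials of `f` have
weight less than `d`. -/
def HasLeadingForm {R σ M : Type*} [CommRing R] [AddCommMonoid M] [LinearOrder M]
    (w : σ → M) (d : M) (f F : MvPolynomial σ R) : Prop :=
  IsWeightedHomogeneous w F d ∧ ∀ s, coeff s (f - F) ≠ 0 → Finsupp.weight w s < d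

section LeadingForm

variable {R σ τ M : Type*} [CommRing R] [AddCommMonoid M] [LinearOrder M]
  {w : σ → M} {d e : M} {f g F G : MvPolynomial σ R}

theorem HasLeadingForm.of_isWeightedHomogeneous (h : IsWeightedHomogeneous w F d) :
    HasLeadingForm w d F F :=
  ⟨h, fun s hs => absurd (by simp) hs⟩

/-- The form 0 is admitted, so that terms of weight below `d` can be absorbed in sums. -/
theorem HasLeadingForm.zero_of_lt (h : ∀ s, coeff s f ≠ 0 → Finsupp.weight w s < d) :
    HasLeadingForm w d f 0 :=
  ⟨isWeightedHomogeneous_zero _ _ _, fun s hs => h s (by simpa using hs)⟩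

theorem HasLeadingForm.add (hf : HasLeadingForm w d f F) (hg : HasLeadingForm w d g G) :
    HasLeadingForm w d (f + g) (F + G) := by
  refine ⟨hf.1.add hg.1, fun s hs => ?_⟩
  rw [add_sub_add_comm, coeff_add] at hs
  by_cases h : coeff s (f - F) = 0
  · rw [h, zero_add] at hs; exact hg.2 s hs
  · exact hf.2 s h

theorem HasLeadingForm.sum {ι : Type*} (S : Finset ι) (f F : ι → MvPolynomial σ R)
    (h : ∀ i ∈ S, HasLeadingForm w d (f i) (F i)) :
    HasLeadingForm w d (∑ i ∈ S, f i) (∑ i ∈ S, F i) := by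
  classical
  induction S using Finset.induction_on with
  | empty => simpa using HasLeadingForm.of_isWeightedHomogeneous (isWeightedHomogeneous_zero R w d)
  | insert i S hi ih =>
    rw [Finset.sum_insert hi, Finset.sum_insert hi]
    exact (h i (Finset.mem_insert_self _ _)).add
      (ih fun j hj => h j (Finset.mem_insert_of_mem hj))

theorem HasLeadingForm.unique {F' : MvPolynomial σ R} (h : HasLeadingForm w d f F)
    (h' : HasLeadingForm w d f F') : F = F' := by
  ext s
  by_contra hne
  have hs : Finsupp.weight w s = d := by
    by_cases h0 : coeff s F = 0
    · rw [h0] at hne; exact h'.1 (Ne.symm hne)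
    · exact h.1 h0
  have h1 : coeff s (f - F) = 0 := by
    by_contra h1; exact (h.2 s h1).ne hs
  have h2 : coeff s (f - F') = 0 := by
    by_contra h1; exact (h'.2 s h1).ne hs
  rw [coeff_sub] at h1 h2
  exact hne ((sub_eq_zero.1 h1).symm.trans (sub_eq_zero.1 h2))

theorem exists_coeff_ne_zero_of_coeff_mul {s : σ →₀ ℕ} (h : coeff s (f * g) ≠ 0) :
    ∃ a b, coeff a f ≠ 0 ∧ coeff b g ≠ 0 ∧ a + b = s := by
  classical
  rw [coeff_mul] at h
  obtain ⟨⟨a, b⟩, hab, hne⟩ := Finset.exists_ne_zero_of_sum_ne_zero h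
  exact ⟨a, b, left_ne_zero_of_mul hne, right_ne_zero_of_mul hne,
    Finset.HasAntidiagonal.mem_antidiagonal.1 hab⟩

variable [IsOrderedCancelAddMonoid M]

theorem HasLeadingForm.mul (hf : HasLeadingForm w d f F) (hg : HasLeadingForm w e g G) :
    HasLeadingForm w (d + e) (f * g) (F * G) := by
  refine ⟨hf.1.mul hg.1, fun s hs => ?_⟩
  have h1 : f * g - F * G = (f - F) * (g - G) + ((f - F) * G + F * (g - G)) := by ring
  rw [h1, coeff_add, coeff_add] at hs
  by_cases h2 : coeff s ((f - F) * (g - G)) = 0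
  · by_cases h3 : coeff s ((f - F) * G) = 0
    · rw [h2, h3, zero_add, zero_add] at hs
      obtain ⟨a, b, ha, hb, rfl⟩ := exists_coeff_ne_zero_of_coeff_mul hs
      rw [map_add, hf.1 ha]
      exact add_lt_add_right (hg.2 b hb) _
    · obtain ⟨a, b, ha, hb, rfl⟩ := exists_coeff_ne_zero_of_coeff_mul h3
      rw [map_add, hg.1 hb]
      exact add_lt_add_left (hf.2 a ha) _
  · obtain ⟨a, b, ha, hb, rfl⟩ := exists_coeff_ne_zero_of_coeff_mul h2
    rw [map_add]
    exact add_lt_add (hf.2 a ha) (hg.2 b hb)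

theorem HasLeadingForm.pow (hf : HasLeadingForm w d f F) (n : ℕ) :
    HasLeadingForm w (n • d) (f ^ n) (F ^ n) := by
  induction n with
  | zero => simpa using HasLeadingForm.of_isWeightedHomogeneous (isWeightedHomogeneous_one R w)
  | succ n ih => rw [pow_succ, pow_succ, succ_nsmul]; exact ih.mul hf

theorem HasLeadingForm.prod {ι : Type*} (S : Finset ι) (f F : ι → MvPolynomial σ R) (d : ι → M)
    (h : ∀ i ∈ S, HasLeadingForm w (d i) (f i) (F i)) :
    HasLeadingForm w (∑ i ∈ S, d i) (∏ i ∈ S, f i) (∏ i ∈ S, F i) := by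
  classical
  induction S using Finset.induction_on with
  | empty => simpa using HasLeadingForm.of_isWeightedHomogeneous (isWeightedHomogeneous_one R w)
  | insert i S hi ih =>
    rw [Finset.sum_insert hi, Finset.prod_insert hi, Finset.prod_insert hi]
    exact (h i (Finset.mem_insert_self _ _)).mul
      (ih fun j hj => h j (Finset.mem_insert_of_mem hj))

/-- Weighted leading forms are compatible with substitution. -/
theorem HasLeadingForm.aeval {v : τ → M} {u U : σ → MvPolynomial τ R}
    (hu : ∀ i, HasLeadingForm v (w i) (u i) (U i)) (hf : HasLeadingForm w d f F) :
    HasLeadingForm v d (aeval u f) (aeval U F) := by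
  have hmon : ∀ (s : σ →₀ ℕ) (c : R), HasLeadingForm v (Finsupp.weight w s)
      (algebraMap R (MvPolynomial τ R) c * s.prod fun i k => u i ^ k)
      (algebraMap R (MvPolynomial τ R) c * s.prod fun i k => U i ^ k) := by
    intro s c
    rw [← zero_add (Finsupp.weight w s)]
    refine (HasLeadingForm.of_isWeightedHomogeneous (isWeightedHomogeneous_C v c)).mul ?_
    rw [Finsupp.weight_apply]
    exact HasLeadingForm.prod _ _ _ _ fun i _ => (hu i).pow _
  have h1 : HasLeadingForm v d (MvPolynomial.aeval u F) (MvPolynomial.aeval U F) := by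
    rw [aeval_def, aeval_def, eval₂_eq, eval₂_eq]
    refine HasLeadingForm.sum _ _ _ fun s hs => ?_
    have := hmon s (coeff s F)
    rwa [hf.1 (mem_support_iff.1 hs)] at this
  -- Monomials of `f - F` weigh less than `d`, and substitution does not raise weights.
  have h2 : HasLeadingForm v d (MvPolynomial.aeval u (f - F)) 0 := by
    rw [aeval_def, eval₂_eq, ← Finset.sum_const_zero (s := (f - F).support)]
    refine HasLeadingForm.sum _ _ _ fun s hs => ?_
    have h3 := hf.2 s (mem_support_iff.1 hs)
    have h4 := hmon s (coeff s (f - F))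
    refine HasLeadingForm.zero_of_lt fun t ht => ?_
    by_contra h5
    have h6 : ¬ Finsupp.weight v t < Finsupp.weight w s :=
      fun h7 => h5 (h7.trans h3)
    have h7 := not_imp_not.2 (h4.2 t) h6
    rw [not_not, coeff_sub, sub_eq_zero] at h7
    have h8 := h4.1 (h7 ▸ ht)
    exact h5 (h8 ▸ h3)
  have h3 := h1.add h2
  rwa [← map_add, add_sub_cancel, add_zero] at h3

end LeadingForm

/-! ### Leading forms of a deformation -/

theorem coeff_aeval_zero {K : Type*} [CommRing K] (f : MvPolynomial (Fin 3) K) (s : Fin 3 →₀ ℕ) :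
    coeff s (aeval (![0, X 1, X 2] : Fin 3 → MvPolynomial (Fin 3) K) f) =
      if s 0 = 0 then coeff s f else 0 := by
  classical
  induction f using MvPolynomial.induction_on' with
  | monomial u a =>
    by_cases hu : u 0 = 0
    · rw [aeval_zero_eq_self]
      · rw [coeff_monomial]
        split_ifs with h1 h2 h2
        · rfl
        · exact absurd (h1 ▸ hu) h2
        · rfl
        · rfl
      · rw [← Nat.le_zero, degreeOf_le_iff]
        intro d hd
        rw [Finset.mem_singleton.1 (support_monomial_subset hd), hu]
    · rw [aeval_monomial, Finsupp.prod_fintype _ _ (by simp), Fin.prod_univ_three]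
      simp only [Matrix.cons_val_zero, zero_pow hu, zero_mul, mul_zero, coeff_zero, coeff_monomial]
      split_ifs with h1 h2
      · exact absurd (h2 ▸ h1) hu
      · rfl
      · rfl
  | add p q hp hq =>
    rw [map_add, coeff_add, hp, hq, coeff_add]
    split_ifs <;> simp

theorem aeval_vecCons_eq {K A : Type*} [CommRing K] [CommRing A] [Algebra K A]
    (φ : MvPolynomial (Fin 2) K →ₐ[K] A) (f : MvPolynomial (Fin 2) K) :
    aeval ![φ (X 0), φ (X 1)] f = φ f := by
  congr 1
  ext i
  fin_cases i <;> simp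

/-- The slope of the Newton polygon determines weights for which a nontrivial deformation of
`(x, y)` has a nontrivial leading form. -/
theorem exists_hasLeadingForm {K : Type*} [CommRing K] (n m : ℕ) {u v : MvPolynomial (Fin 3) K}
    (hu : aeval ![0, X 1, X 2] u = (X 1 : MvPolynomial (Fin 3) K))
    (hv : aeval ![0, X 1, X 2] v = (X 2 : MvPolynomial (Fin 3) K))
    (huv : ¬ (u = X 1 ∧ v = X 2)) :
    ∃ (t : ℚ) (U V : MvPolynomial (Fin 3) K),
      HasLeadingForm ![t, n, m] (n : ℚ) u U ∧ HasLeadingForm ![t, n, m] (m : ℚ) v V ∧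
      aeval ![0, X 1, X 2] U = (X 1 : MvPolynomial (Fin 3) K) ∧
      aeval ![0, X 1, X 2] V = (X 2 : MvPolynomial (Fin 3) K) ∧ ¬ (U = X 1 ∧ V = X 2) := by
  classical
  have hpos : ∀ (f g : MvPolynomial (Fin 3) K),
      aeval (![0, X 1, X 2] : Fin 3 → MvPolynomial (Fin 3) K) f = g →
      aeval (![0, X 1, X 2] : Fin 3 → MvPolynomial (Fin 3) K) g = g →
      ∀ s ∈ (f - g).support, (0 : ℚ) < s 0 := by
    intro f g hf hg s hs
    have h1 := coeff_aeval_zero (f - g) s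
    rw [map_sub, hf, hg, sub_self, coeff_zero] at h1
    by_contra h2
    have h3 : s 0 = 0 := by
      by_contra h3; exact h2 (by exact_mod_cast Nat.pos_of_ne_zero h3)
    rw [if_pos h3] at h1
    exact mem_support_iff.1 hs h1.symm
  have hu' := hpos u (X 1) hu (by simp)
  have hv' := hpos v (X 2) hv (by simp)
  -- `slope a s` is the weight of the parameter at which the monomial `s` gets total weight `a`. The
  -- minimum over all perturbation terms keeps every term at or below its target and puts at least
  -- one exactly on it. It may be fractional or negative, hence weights in `ℚ`.
  let slope : ℕ → (Fin 3 →₀ ℕ) → ℚ := fun a s => (a - n * s 1 - m * s 2) / s 0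
  let S := (u - X 1).support.image (slope n) ∪ (v - X 2).support.image (slope m)
  have hS : S.Nonempty := by
    rw [Finset.union_nonempty, Finset.image_nonempty, Finset.image_nonempty]
    by_contra! h
    simp only [support_eq_empty, sub_eq_zero] at h
    exact huv h
  set t := S.min' hS
  have hweight : ∀ s : Fin 3 →₀ ℕ,
      Finsupp.weight (![t, n, m] : Fin 3 → ℚ) s = s 0 * t + s 1 * n + s 2 * m := by
    intro s
    rw [Finsupp.weight_apply, Finsupp.sum_fintype _ _ (by simp), Fin.sum_univ_three]
    simp
  have hle : ∀ (a : ℕ) (s : Fin 3 →₀ ℕ), (0 : ℚ) < s 0 → t ≤ slope a s →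
      Finsupp.weight (![t, n, m] : Fin 3 → ℚ) s ≤ a := by
    intro a s hs h
    rw [le_div_iff₀ hs] at h
    rw [hweight]; linarith
  have heq : ∀ (a : ℕ) (s : Fin 3 →₀ ℕ), (0 : ℚ) < s 0 → slope a s = t →
      Finsupp.weight (![t, n, m] : Fin 3 → ℚ) s = a := by
    intro a s hs h
    rw [div_eq_iff hs.ne'] at h
    rw [hweight]; linarith
  have hlead : ∀ (a : ℕ) (i : Fin 3) (f : MvPolynomial (Fin 3) K),
      (![t, n, m] : Fin 3 → ℚ) i = a →
      aeval (![0, X 1, X 2] : Fin 3 → MvPolynomial (Fin 3) K) (X i : MvPolynomial (Fin 3) K) = X i →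
      (∀ s ∈ (f - X i).support, (0 : ℚ) < s 0) →
      (∀ s ∈ (f - X i).support, t ≤ slope a s) →
      HasLeadingForm ![t, n, m] (a : ℚ) f
        (X i + weightedHomogeneousComponent ![t, n, m] (a : ℚ) (f - X i)) ∧
      aeval (![0, X 1, X 2] : Fin 3 → MvPolynomial (Fin 3) K)
        (X i + weightedHomogeneousComponent ![t, n, m] (a : ℚ) (f - X i)) = X i := by
    intro a i f hi hXi hf hs
    refine ⟨⟨?_, ?_⟩, ?_⟩
    · refine IsWeightedHomogeneous.add ?_ 
        (weightedHomogeneousComponent_isWeightedHomogeneous _ _)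
      rw [← hi]; exact isWeightedHomogeneous_X _ _ _
    · intro s hs'
      rw [← sub_sub, coeff_sub, coeff_weightedHomogeneousComponent] at hs'
      split_ifs at hs' with h1
      · simp at hs'
      · rw [sub_zero] at hs'
        have h2 := mem_support_iff.2 hs'
        exact lt_of_le_of_ne (hle a s (hf s h2) (hs s h2)) h1
    · rw [map_add, hXi, add_eq_left]
      ext s
      rw [coeff_aeval_zero, coeff_zero, coeff_weightedHomogeneousComponent]
      split_ifs with h1 h2
      · by_contra h3
        have := hf s (mem_support_iff.2 h3)
        rw [h1] at this; simp at this
      · rfl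
      · rfl
  obtain ⟨hU1, hU2⟩ := hlead n 1 u rfl (by simp) hu' fun s hs =>
    Finset.min'_le _ _ (Finset.mem_union_left _ (Finset.mem_image_of_mem _ hs))
  obtain ⟨hV1, hV2⟩ := hlead m 2 v rfl (by simp) hv' fun s hs =>
    Finset.min'_le _ _ (Finset.mem_union_right _ (Finset.mem_image_of_mem _ hs))
  refine ⟨t, _, _, hU1, hV1, hU2, hV2, ?_⟩
  rw [add_eq_left, add_eq_left]
  rintro ⟨h1, h2⟩
  rcases Finset.mem_union.1 (Finset.min'_mem S hS) with h3 | h3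
  · obtain ⟨s, hs, hst⟩ := Finset.mem_image.1 h3
    have h4 := congrArg (coeff s) h1
    rw [coeff_weightedHomogeneousComponent, if_pos (heq n s (hu' s hs) hst)] at h4
    exact mem_support_iff.1 hs h4
  · obtain ⟨s, hs, hst⟩ := Finset.mem_image.1 h3
    have h4 := congrArg (coeff s) h2
    rw [coeff_weightedHomogeneousComponent, if_pos (heq m s (hv' s hs) hst)] at h4
    exact mem_support_iff.1 hs h4

/-- If a nontrivial deformation of `K[x, y]` fixes `h`, then `x ^ p - c y ^ q` can divide a weighted
leading form of `h` only if `p ≤ 1` or `q ≤ 1`. -/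
theorem le_one_of_binomial_dvd {K : Type*} [Field K]
    (ε : MvPolynomial (Fin 2) K →ₐ[K] MvPolynomial (Fin 3) K) {h : MvPolynomial (Fin 2) K}
    (hε : ε h = aeval ![X 1, X 2] h)
    (hX0 : aeval ![0, X 1, X 2] (ε (X 0)) = (X 1 : MvPolynomial (Fin 3) K))
    (hX1 : aeval ![0, X 1, X 2] (ε (X 1)) = (X 2 : MvPolynomial (Fin 3) K))
    (hne : ¬ (ε (X 0) = X 1 ∧ ε (X 1) = X 2)) (n m : ℕ) {W : ℚ} {f : MvPolynomial (Fin 2) K}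
    (hf0 : f ≠ 0) (hf : HasLeadingForm ![(n : ℚ), (m : ℚ)] W h f) {p q : ℕ} (hpq : p.Coprime q)
    {c : K} (hc : c ≠ 0) (hdvd : (X 0 ^ p - C c * X 1 ^ q : MvPolynomial (Fin 2) K) ∣ f) :
    p ≤ 1 ∨ q ≤ 1 := by
  by_contra! hlt
  obtain ⟨t, U, V, hU, hV, hU', hV', hUV⟩ := exists_hasLeadingForm n m hX0 hX1 hne
  have h1 : HasLeadingForm ![t, n, m] W (aeval ![ε (X 0), ε (X 1)] h) (aeval ![U, V] f) := by
    refine HasLeadingForm.aeval (fun i => ?_) hf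
    fin_cases i
    · exact hU
    · exact hV
  have h2 : HasLeadingForm ![t, n, m] W (aeval ![X 1, X 2] h)
      (aeval ![X 1, X 2] f : MvPolynomial (Fin 3) K) := by
    refine HasLeadingForm.aeval (fun i => ?_) hf
    fin_cases i
    · exact HasLeadingForm.of_isWeightedHomogeneous
        (isWeightedHomogeneous_X K (![t, n, m] : Fin 3 → ℚ) 1)
    · exact HasLeadingForm.of_isWeightedHomogeneous
        (isWeightedHomogeneous_X K (![t, n, m] : Fin 3 → ℚ) 2)
  rw [aeval_vecCons_eq, hε] at h1
  -- Both are leading forms of the same polynomial because `ε` fixes `h`; hence `f(U, V) = f(x, y)`.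
  have h4 := h1.unique h2
  have hρ : aeval (![0, X 1, X 2] : Fin 3 → MvPolynomial (Fin 3) K)
      (aeval ![X 1, X 2] f : MvPolynomial (Fin 3) K) =
      (aeval ![X 1, X 2] f : MvPolynomial (Fin 3) K) := by
    rw [MvPolynomial.comp_aeval_apply]
    congr 2
    funext i; fin_cases i <;> simp
  have hι0 : (aeval ![X 1, X 2] f : MvPolynomial (Fin 3) K) ≠ 0 := by
    intro h0
    have h5 := congrArg (aeval (![0, X 0, X 1] : Fin 3 → MvPolynomial (Fin 2) K)) h0
    rw [MvPolynomial.comp_aeval_apply, map_zero] at h5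
    apply hf0
    rw [← h5]
    conv_lhs => rw [← aeval_X_left_apply (p := f)]
    congr 2
    funext i; fin_cases i <;> simp
  have hι : degreeOf 0 (aeval ![X 1, X 2] f : MvPolynomial (Fin 3) K) = 0 := by
    rw [← Nat.le_zero, degreeOf_le_iff]
    intro s hs
    rw [← hρ, mem_support_iff, coeff_aeval_zero] at hs
    by_contra h5
    rw [if_neg (by omega)] at hs
    exact hs rfl
  have h5 : (U ^ p - C c * V ^ q) ∣ (aeval ![X 1, X 2] f : MvPolynomial (Fin 3) K) := by
    rw [← h4]
    have := map_dvd (MvPolynomial.aeval (R := K) ![U, V]) hdvd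
    simpa using this
  obtain ⟨g, hg⟩ := h5
  -- A factor of a nonzero polynomial free of `t` is free of `t`, so it equals its value `x ^ p - c
  -- y ^ q` at `t = 0`.
  have h6 : degreeOf 0 (U ^ p - C c * V ^ q) = 0 := by
    rw [hg] at hι hι0
    rw [degreeOf_mul_eq (left_ne_zero_of_mul hι0) (right_ne_zero_of_mul hι0)] at hι
    omega
  have h7 := aeval_zero_eq_self h6
  rw [map_sub, map_mul, map_pow, map_pow, hU', hV', algHom_C, algebraMap_eq] at h7
  exact hUV (eq_X_of_binomial_eq hlt.1 hlt.2 hpq hc hU' hV' h7.symm)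

/-! ### The deformation that translates the partner of `h` -/

section Deformation

variable {K : Type*} [Field K]
  (α : MvPolynomial (Fin 2) K ≃ₐ[K] Polynomial (Polynomial K))

/-- The deformation `g ↦ g + t` of `K[h, g] = K[x, y]` over `K[h]`. -/
noncomputable def translation : MvPolynomial (Fin 2) K →ₐ[K] MvPolynomial (Fin 3) K :=
  (Polynomial.aevalAeval (aeval ![X 1, X 2] (α.symm (Polynomial.C Polynomial.X)))
    (aeval ![X 1, X 2] (α.symm Polynomial.X) + X 0)).comp (α : _ →ₐ[K] _)

theorem translation_fst : translation α (α.symm (Polynomial.C Polynomial.X)) =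
    aeval ![X 1, X 2] (α.symm (Polynomial.C Polynomial.X)) := by
  simp [translation]

theorem translation_snd : translation α (α.symm Polynomial.X) =
    aeval ![X 1, X 2] (α.symm Polynomial.X) + X 0 := by
  simp [translation]

theorem algHom_ext_of_algEquiv {A : Type*} [CommRing A] [Algebra K A]
    {f g : MvPolynomial (Fin 2) K →ₐ[K] A}
    (h1 : f (α.symm (Polynomial.C Polynomial.X)) = g (α.symm (Polynomial.C Polynomial.X)))
    (h2 : f (α.symm Polynomial.X) = g (α.symm Polynomial.X)) : f = g := by
  have h3 : f.comp (α.symm : Polynomial (Polynomial K) →ₐ[K] _) =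
      g.comp (α.symm : Polynomial (Polynomial K) →ₐ[K] _) := by
    apply (Polynomial.aevalAevalEquiv K A).symm.injective
    exact Prod.ext h1 h2
  ext i
  have := DFunLike.congr_fun h3 (α (X i))
  simpa using this

/-- It suffices to compare on the generators `h` and `g`; there the only change is the summand `t`.
-/
theorem aeval_zero_translation (f : MvPolynomial (Fin 2) K) :
    aeval ![0, X 1, X 2] (translation α f) = (aeval ![X 1, X 2] f : MvPolynomial (Fin 3) K) := by
  have hρ : ∀ f : MvPolynomial (Fin 2) K,
      aeval (![0, X 1, X 2] : Fin 3 → MvPolynomial (Fin 3) K)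
        (aeval ![X 1, X 2] f : MvPolynomial (Fin 3) K) = aeval ![X 1, X 2] f := by
    intro f
    rw [MvPolynomial.comp_aeval_apply]
    congr 2
    funext i; fin_cases i <;> simp
  refine DFunLike.congr_fun (f := (aeval ![0, X 1, X 2]).comp (translation α))
    (algHom_ext_of_algEquiv α ?_ ?_) f
  · rw [AlgHom.comp_apply, translation_fst, hρ]
  · rw [AlgHom.comp_apply, translation_snd, map_add, hρ]; simp

theorem translation_nontrivial : ¬ (translation α (X 0) = X 1 ∧ translation α (X 1) = X 2) := by
  rintro ⟨h1, h2⟩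
  have h3 := translation_snd α
  rw [← aeval_vecCons_eq (translation α), h1, h2, left_eq_add] at h3
  exact X_ne_zero 0 h3

end Deformation

/-! ### The division step -/

/-- Only monomials of weight exactly `W` reach degree `W`. Summed over the monomials of `h`, this
turns the top coefficient of `h(a, b)` into the leading form evaluated at the leading coefficients.
-/
theorem coeff_pow_mul_pow_eq {K : Type*} [CommRing K] {a b : Polynomial K} (i j : ℕ) {W : ℕ}
    (h : i * a.natDegree + j * b.natDegree ≤ W) :
    (a ^ i * b ^ j).coeff W = if i * a.natDegree + j * b.natDegree = W then
      a.leadingCoeff ^ i * b.leadingCoeff ^ j else 0 := by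
  split_ifs with h1
  · rw [← h1, Polynomial.coeff_mul_add_eq_of_natDegree_le Polynomial.natDegree_pow_le
      Polynomial.natDegree_pow_le, Polynomial.coeff_pow_of_natDegree_le le_rfl,
      Polynomial.coeff_pow_of_natDegree_le le_rfl]
    rfl
  · refine Polynomial.coeff_eq_zero_of_natDegree_lt ?_
    refine lt_of_le_of_lt (Polynomial.natDegree_mul_le.trans
      (Nat.add_le_add Polynomial.natDegree_pow_le Polynomial.natDegree_pow_le)) ?_
    omega

theorem natDegree_sub_lt_of_leadingCoeff_eq {K : Type*} [Field K]
    {a b : Polynomial (Polynomial K)} {d : ℕ} {c : K} (ha : 0 < a.natDegree)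
    (hab : a.natDegree = d * b.natDegree)
    (hc : a.leadingCoeff = Polynomial.C c * b.leadingCoeff ^ d) :
    (a - Polynomial.C (Polynomial.C c) * b ^ d).natDegree < a.natDegree := by
  have h0 : a ≠ 0 := by rintro rfl; simp at ha
  have hlc : (Polynomial.C (Polynomial.C c) * b ^ d).leadingCoeff = a.leadingCoeff := by
    rw [Polynomial.leadingCoeff_mul, Polynomial.leadingCoeff_C, Polynomial.leadingCoeff_pow, hc]
  have hcne : Polynomial.C c ≠ 0 := by
    intro h1
    rw [h1, Polynomial.C_0, zero_mul, Polynomial.leadingCoeff_zero] at hlc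
    exact h0 (Polynomial.leadingCoeff_eq_zero.1 hlc.symm)
  have hdeg : (Polynomial.C (Polynomial.C c) * b ^ d).natDegree = a.natDegree := by
    rw [Polynomial.natDegree_C_mul hcne, Polynomial.natDegree_pow, hab]
  -- A vanishing difference has `natDegree` 0, so strictness then rests on `ha`.
  by_cases hz : a - Polynomial.C (Polynomial.C c) * b ^ d = 0
  · rwa [hz, Polynomial.natDegree_zero]
  · refine Polynomial.natDegree_lt_natDegree hz (Polynomial.degree_sub_lt_left ?_ h0 hlc.symm)
    rw [Polynomial.degree_eq_natDegree h0, Polynomial.degree_eq_natDegree, hdeg]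
    rintro h1
    rw [h1, Polynomial.natDegree_zero] at hdeg
    omega

/-- The division step for automorphisms of `K[x, y]`: the leading coefficient of one of the
generators is a multiple of a power of that of the other one. -/
theorem exists_natDegree_sub_lt {K : Type*} [Field K]
    (α : MvPolynomial (Fin 2) K ≃ₐ[K] Polynomial (Polynomial K))
    (hn : 0 < (α (X 0)).natDegree) (hm : 0 < (α (X 1)).natDegree) :
    ∃ i j : Fin 2, i ≠ j ∧ ∃ (d : ℕ) (c : K),
      (α (X i)).natDegree = d * (α (X j)).natDegree ∧
      (α (X i) - Polynomial.C (Polynomial.C c) * α (X j) ^ d).natDegree <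
        (α (X i)).natDegree := by
  classical
  set a := α (X 0) with ha
  set b := α (X 1) with hb
  set h := α.symm (Polynomial.C Polynomial.X) with hh
  set n := a.natDegree with hn'
  set m := b.natDegree with hm'
  have ha0 : a ≠ 0 := by rintro h0; rw [hn', h0] at hn; simp at hn
  have hb0 : b ≠ 0 := by rintro h0; rw [hm', h0] at hm; simp at hm
  have hαh : α h = Polynomial.C Polynomial.X := by simp [hh]
  set W := h.support.sup fun s => s 0 * n + s 1 * m with hWdef
  have hle : ∀ s ∈ h.support, s 0 * n + s 1 * m ≤ W := fun s hs =>
    Finset.le_sup (f := fun s : Fin 2 →₀ ℕ => s 0 * n + s 1 * m) hs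
  have hsupp : h.support.Nonempty := by
    rw [Finset.nonempty_iff_ne_empty, Ne, support_eq_empty]
    intro h0
    rw [h0, map_zero] at hαh
    exact Polynomial.X_ne_zero (Polynomial.C_injective (hαh.symm.trans Polynomial.C_0.symm))
  -- With positive weights, `W = 0` would make `h` constant.
  have hWpos : 0 < W := by
    rw [Nat.pos_iff_ne_zero]
    intro hW0
    have h1 : h = C (coeff 0 h) := by
      ext s
      rw [coeff_C]
      split_ifs with h2
      · rw [h2]
      · by_contra h3
        have h4 := hle s (mem_support_iff.2 h3)
        rw [hW0] at h4
        apply h2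
        ext i
        fin_cases i
        · change 0 = s 0
          nlinarith [Nat.zero_le (s 1 * m), Nat.zero_le (s 0 * n), Nat.zero_le (s 0)]
        · change 0 = s 1
          nlinarith [Nat.zero_le (s 1 * m), Nat.zero_le (s 0 * n), Nat.zero_le (s 1)]
    rw [h1] at hαh
    have h2 : α (C (coeff 0 h)) = Polynomial.C (Polynomial.C (coeff 0 h)) := α.commutes _
    rw [h2] at hαh
    have h3 := congrArg Polynomial.natDegree (Polynomial.C_injective hαh)
    simp at h3
  have hwt : ∀ s : Fin 2 →₀ ℕ, Finsupp.weight ![n, m] s = s 0 * n + s 1 * m := by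
    intro s
    rw [Finsupp.weight_apply, Finsupp.sum_fintype _ _ (by simp), Fin.sum_univ_two]
    simp
  have hwtQ : ∀ s : Fin 2 →₀ ℕ, Finsupp.weight ![(n : ℚ), (m : ℚ)] s =
      ((s 0 * n + s 1 * m : ℕ) : ℚ) := by
    intro s
    rw [Finsupp.weight_apply, Finsupp.sum_fintype _ _ (by simp), Fin.sum_univ_two]
    simp
  set f := weightedHomogeneousComponent ![n, m] W h with hf
  have hcoeff : ∀ s, coeff s f = if s 0 * n + s 1 * m = W then coeff s h else 0 := by
    intro s
    rw [hf, coeff_weightedHomogeneousComponent, hwt]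
  have hf0 : f ≠ 0 := by
    obtain ⟨s, hs, hsW⟩ := Finset.exists_mem_eq_sup h.support hsupp
      fun s : Fin 2 →₀ ℕ => s 0 * n + s 1 * m
    intro h0
    have h1 := hcoeff s
    rw [if_pos hsW.symm, h0, coeff_zero] at h1
    exact mem_support_iff.1 hs h1.symm
  have hlead : HasLeadingForm ![(n : ℚ), (m : ℚ)] (W : ℚ) h f := by
    refine ⟨fun s hs => ?_, fun s hs => ?_⟩
    · rw [hcoeff] at hs
      rw [hwtQ]
      exact congrArg _ (by_contra fun h1 => hs (if_neg h1))
    · rw [hwtQ, Nat.cast_lt]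
      rw [coeff_sub, hcoeff] at hs
      split_ifs at hs with h1
      · simp at hs
      · rw [sub_zero] at hs
        exact lt_of_le_of_ne (hle s (mem_support_iff.2 hs)) h1
  -- `α h` has degree 0 in the outer variable, so its coefficient in degree `W > 0` vanishes.
  have hvanish : aeval ![a.leadingCoeff, b.leadingCoeff] f = 0 := by
    have h1 : (α h).coeff W = 0 := by
      rw [hαh, Polynomial.coeff_C, if_neg hWpos.ne']
    rw [← h1]
    have h2 : α h = aeval ![a, b] h :=
      (aeval_vecCons_eq (α : _ →ₐ[K] Polynomial (Polynomial K)) h).symm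
    rw [h2, aeval_def, aeval_def, eval₂_eq', eval₂_eq', Polynomial.finsetSum_coeff]
    have hfs : f.support ⊆ h.support := by
      intro s hs
      rw [mem_support_iff, hcoeff] at hs
      rw [mem_support_iff]
      intro h3
      rw [h3, ite_self] at hs
      exact hs rfl
    rw [Finset.sum_subset hfs fun s _ hs => by rw [notMem_support_iff.1 hs]; simp]
    refine Finset.sum_congr rfl fun s hs => ?_
    rw [Fin.prod_univ_two, Fin.prod_univ_two]
    simp only [Matrix.cons_val_zero, Matrix.cons_val_one]
    have h3 : algebraMap K (Polynomial (Polynomial K)) (coeff s h) =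
      Polynomial.C (Polynomial.C (coeff s h)) := rfl
    rw [h3, Polynomial.coeff_C_mul, coeff_pow_mul_pow_eq _ _ (hle s hs), hcoeff]
    split_ifs
    · rfl
    · simp
  -- Dividing the weights by their gcd makes them coprime. The exponents cross over: `p` comes from
  -- `m` and `q` from `n`, so that `x ^ p` and `y ^ q` have equal weight.
  obtain ⟨e, he⟩ : ∃ e, e = n.gcd m := ⟨_, rfl⟩
  have he0 : 0 < e := he ▸ Nat.gcd_pos_of_pos_left _ hn
  obtain ⟨q, hq⟩ : e ∣ n := he ▸ Nat.gcd_dvd_left _ _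
  obtain ⟨p, hp⟩ : e ∣ m := he ▸ Nat.gcd_dvd_right _ _
  have hpq : p.Coprime q := by
    have h1 : e * Nat.gcd q p = e * 1 := by rw [← Nat.gcd_mul_left, ← hq, ← hp, ← he, mul_one]
    exact Nat.Coprime.symm (Nat.eq_of_mul_eq_mul_left he0 h1)
  have hp0 : 0 < p := Nat.pos_of_mul_pos_left (hp ▸ hm)
  have hq0 : 0 < q := Nat.pos_of_mul_pos_left (hq ▸ hn)
  obtain ⟨c, hc0, hc, hdvd⟩ := exists_binomial_dvd (W := W / e) hp0 hq0 hpq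
    (Polynomial.leadingCoeff_ne_zero.2 ha0) (Polynomial.leadingCoeff_ne_zero.2 hb0) hf0
    (fun s hs => by
      rw [mem_support_iff, hcoeff] at hs
      have h1 : s 0 * n + s 1 * m = W := by_contra fun h1 => hs (if_neg h1)
      rw [← h1, hq, hp]
      refine (Nat.div_eq_of_eq_mul_right he0 ?_).symm
      ring) hvanish
  have hιX0 := aeval_zero_translation α (X 0)
  have hιX1 := aeval_zero_translation α (X 1)
  rw [aeval_X] at hιX0 hιX1
  rcases le_one_of_binomial_dvd (translation α) (translation_fst α) hιX0 hιX1
    (translation_nontrivial α) n m hf0 hlead hpq hc0 hdvd with h1 | h1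
  · have hp1 : p = 1 := by omega
    rw [hp1, mul_one] at hp
    rw [hp1, pow_one] at hc
    have hnm : n = q * m := by rw [hq, hp, mul_comm]
    exact ⟨0, 1, by decide, q, c, hnm, natDegree_sub_lt_of_leadingCoeff_eq hn hnm hc⟩
  · have hq1 : q = 1 := by omega
    rw [hq1, mul_one] at hq
    rw [hq1, pow_one] at hc
    have hnm : m = p * n := by rw [hq, hp, mul_comm]
    refine ⟨1, 0, by decide, p, c⁻¹, hnm, natDegree_sub_lt_of_leadingCoeff_eq hm hnm ?_⟩
    rw [hc, ← mul_assoc, ← Polynomial.C_mul, inv_mul_cancel₀ hc0, Polynomial.C_1, one_mul]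

/-! ### Coordinates as isomorphisms with `K[h][g]` -/

/-- The kernels of the powers `f ^ n` stabilize. Writing `x` in the kernel of `f` as `f ^ n y` puts
`y` in the kernel of `f ^ (n + 1)`, hence of `f ^ n`, so `x = 0`. -/
theorem injective_of_surjective_endomorphism {A : Type*} [CommRing A] [IsNoetherianRing A]
    (f : A →+* A) (hf : Function.Surjective f) : Function.Injective f := by
  let g : ℕ →o Ideal A :=
    { toFun := fun n => RingHom.ker (f ^ n)
      monotone' := by
        refine monotone_nat_of_le_succ fun n x hx => ?_
        rw [RingHom.mem_ker] at hx ⊢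
        rw [pow_succ', RingHom.mul_def, RingHom.comp_apply, hx, map_zero] }
  obtain ⟨n, hn⟩ := monotone_stabilizes_iff_noetherian.2 ‹IsNoetherianRing A› g
  have hsurj : Function.Surjective (f ^ n) := by
    rw [RingHom.coe_pow]; exact hf.iterate n
  rw [injective_iff_map_eq_zero]
  intro x hx
  obtain ⟨y, rfl⟩ := hsurj x
  have h1 : y ∈ g (n + 1) := by
    change (f ^ (n + 1)) y = 0
    rw [pow_succ', RingHom.mul_def, RingHom.comp_apply, hx]
  rw [← hn (n + 1) (Nat.le_succ n)] at h1
  exact h1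

/-- The endomorphism `x ↦ h`, `y ↦ g` is surjective, hence bijective by noetherianity. In the target
the inner variable stands for `h`, so `natDegree` measures the degree in `g` over `K[h]`. -/
theorem IsCoordinate.exists_algEquiv {K : Type*} [Field K] {h : MvPolynomial (Fin 2) K}
    (hh : IsCoordinate h) : ∃ α : MvPolynomial (Fin 2) K ≃ₐ[K] Polynomial (Polynomial K),
      α.symm (Polynomial.C Polynomial.X) = h := by
  obtain ⟨g, hg⟩ := hh
  let ψ : MvPolynomial (Fin 2) K →ₐ[K] MvPolynomial (Fin 2) K := aeval ![h, g]
  have hsurj : Function.Surjective ψ := by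
    rw [← AlgHom.range_eq_top, ← top_le_iff, ← hg, Algebra.adjoin_le_iff]
    rintro x (rfl | rfl)
    · exact ⟨X 0, by simp [ψ]⟩
    · exact ⟨X 1, by simp [ψ]⟩
  have hinj := injective_of_surjective_endomorphism ψ.toRingHom hsurj
  refine ⟨((Polynomial.Bivariate.equivMvPolynomial K).trans
    (AlgEquiv.ofBijective ψ ⟨hinj, hsurj⟩)).symm, ?_⟩
  simp [ψ]

/-! ### Torus action and semi-invariant coordinates -/

/-- The diagonal action of the torus. -/
noncomputable def diagonal {K : Type*} [CommRing K] (a : Fin 2 → K) :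
    MvPolynomial (Fin 2) K →ₐ[K] MvPolynomial (Fin 2) K :=
  aeval fun i => C (a i) * X i

@[simp]
theorem diagonal_X {K : Type*} [CommRing K] (a : Fin 2 → K) (i : Fin 2) :
    diagonal a (X i) = C (a i) * X i := by
  simp [diagonal]

theorem algEquiv_C {K : Type*} [CommRing K]
    (α : MvPolynomial (Fin 2) K ≃ₐ[K] Polynomial (Polynomial K)) (a : K) :
    α (C a) = Polynomial.C (Polynomial.C a) :=
  α.commutes a

/-- If the torus element `a` preserves the line spanned by `h`, then the division step is
compatible with the action of `a`. -/
theorem eq_pow_of_diagonal_eq {K : Type*} [Field K]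
    (α : MvPolynomial (Fin 2) K ≃ₐ[K] Polynomial (Polynomial K)) {a : Fin 2 → K}
    (ha : ∀ i, a i ≠ 0) {χ : K} (hχ : χ ≠ 0)
    (hdiag : diagonal a (α.symm (Polynomial.C Polynomial.X)) =
      C χ * α.symm (Polynomial.C Polynomial.X)) {i j : Fin 2} {d : ℕ} {c : K}
    (hdeg : (α (X i)).natDegree = d * (α (X j)).natDegree)
    (hlt : (α (X i) - Polynomial.C (Polynomial.C c) * α (X j) ^ d).natDegree <
      (α (X i)).natDegree) : a i = a j ^ d := by
  let σ : Polynomial (Polynomial K) →ₐ[K] Polynomial (Polynomial K) :=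
    ((α : _ →ₐ[K] Polynomial (Polynomial K)).comp (diagonal a)).comp
      (α.symm : Polynomial (Polynomial K) →ₐ[K] _)
  have hσ : ∀ f, σ (α f) = α (diagonal a f) := fun f => by simp [σ]
  have hσX : ∀ l, σ (α (X l)) = Polynomial.C (Polynomial.C (a l)) * α (X l) := by
    intro l
    rw [hσ, diagonal_X, map_mul, algEquiv_C]
  let τ : Polynomial K →ₐ[K] Polynomial K := Polynomial.aeval (Polynomial.C χ * Polynomial.X)
  have hτ : Function.Injective (τ : Polynomial K →+* Polynomial K) := by
    rw [injective_iff_map_eq_zero]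
    intro q hq
    have hq' : q.comp (Polynomial.C χ * Polynomial.X) = 0 := by
      rw [Polynomial.comp_eq_aeval]; exact hq
    rcases Polynomial.comp_eq_zero_iff.1 hq' with h0 | ⟨-, h0⟩
    · exact h0
    · have := congrArg Polynomial.natDegree h0
      rw [Polynomial.natDegree_C_mul_X _ hχ, Polynomial.natDegree_C] at this
      omega
  have hσC : ∀ q : Polynomial K, σ (Polynomial.C q) = Polynomial.C (τ q) := by
    have h1 : σ.comp (Polynomial.CAlgHom) = (Polynomial.CAlgHom (R := K)).comp τ := by
      ext1
      change σ (Polynomial.C Polynomial.X) = Polynomial.C (τ Polynomial.X)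
      rw [← α.apply_symm_apply (Polynomial.C Polynomial.X), hσ, hdiag, map_mul, algEquiv_C,
        α.apply_symm_apply]
      simp [τ]
    exact fun q => DFunLike.congr_fun h1 q
  -- `σ` is the torus element transported to `K[h][g]`. It acts on `K[h]` by the injective map `τ`,
  -- so it multiplies all degrees in `g` by that of `σ g`; the eigenvector `α (X i)` of positive
  -- degree shows that this factor is 1.
  have hσcomp : ∀ f, σ f = (f.map (τ : Polynomial K →+* Polynomial K)).comp (σ Polynomial.X) := by
    intro f
    induction f using Polynomial.induction_on' with
    | add p q hp hq => rw [map_add, hp, hq, Polynomial.map_add, Polynomial.add_comp]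
    | monomial n q =>
      rw [← Polynomial.C_mul_X_pow_eq_monomial, map_mul, map_pow, hσC]
      simp
  have hσdeg : ∀ f, (σ f).natDegree = f.natDegree * (σ Polynomial.X).natDegree := by
    intro f
    rw [hσcomp, Polynomial.natDegree_comp, Polynomial.natDegree_map_eq_of_injective hτ]
  have hCC : ∀ b : K, b ≠ 0 → (Polynomial.C b : Polynomial K) ≠ 0 := fun b hb => by simpa using hb
  have hδ : (σ Polynomial.X).natDegree = 1 := by
    have h1 := hσdeg (α (X i))
    rw [hσX, Polynomial.natDegree_C_mul (hCC _ (ha i))] at h1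
    have h2 : 0 < (α (X i)).natDegree := by omega
    exact Nat.eq_of_mul_eq_mul_left h2 (by rw [← h1, mul_one])
  by_contra hne
  set w := α (X i) - Polynomial.C (Polynomial.C c) * α (X j) ^ d with hw
  have hσw : (σ w).natDegree < (α (X i)).natDegree := by
    rw [hσdeg, hδ, mul_one]; exact hlt
  have hc : c ≠ 0 := by
    rintro rfl
    simp [hw] at hlt
  -- If `a i ≠ a j ^ d`, the right side has the full degree of `α (X i)`, while both terms on the
  -- left have smaller degree.
  have h1 : σ w - Polynomial.C (Polynomial.C (a i)) * w =
      Polynomial.C (Polynomial.C (c * (a i - a j ^ d))) * α (X j) ^ d := by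
    have h2 : σ (Polynomial.C (Polynomial.C c)) = Polynomial.C (Polynomial.C c) := σ.commutes c
    rw [hw, map_sub, map_mul, map_pow, hσX, hσX, h2]
    simp only [Polynomial.C_mul, Polynomial.C_sub, Polynomial.C_pow]
    ring
  have h2 := congrArg Polynomial.natDegree h1
  rw [Polynomial.natDegree_C_mul (hCC _ (mul_ne_zero hc (sub_ne_zero.2 hne))),
    Polynomial.natDegree_pow, ← hdeg] at h2
  have h3 := Polynomial.natDegree_sub_le (σ w) (Polynomial.C (Polynomial.C (a i)) * w)
  rw [h2, Polynomial.natDegree_C_mul (hCC _ (ha i))] at h3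
  exact absurd h3 (not_le.2 (max_lt hσw hlt))

/-- If one of the variables lies in `K[h]`, then `h` is an affine function of this variable. -/
theorem exists_eq_of_natDegree_eq_zero {K : Type*} [Field K]
    (α : MvPolynomial (Fin 2) K ≃ₐ[K] Polynomial (Polynomial K)) {j : Fin 2}
    (hj : (α (X j)).natDegree = 0) : ∃ a b : K, a ≠ 0 ∧
      α.symm (Polynomial.C Polynomial.X) = C a * X j + C b := by
  obtain ⟨q, hq⟩ := Polynomial.natDegree_eq_zero.1 hj
  set h := α.symm (Polynomial.C Polynomial.X) with hh
  have h1 : X j = Polynomial.aeval h q := by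
    have h2 : ((α.symm : Polynomial (Polynomial K) →ₐ[K] MvPolynomial (Fin 2) K).comp
        Polynomial.CAlgHom) = Polynomial.aeval h := by
      ext1
      simp [hh]
    rw [← h2, AlgHom.comp_apply]
    change _ = α.symm (Polynomial.C q)
    rw [hq, α.symm_apply_apply]
  have h2 : q.natDegree = 1 := by
    -- Restricting to the `j`-th axis gives `T = q(h(T))`, and degrees multiply under composition.
    have h3 := congrArg (aeval (Pi.single j Polynomial.X : Fin 2 → Polynomial K)) h1
    rw [aeval_X, Pi.single_eq_same, ← Polynomial.aeval_algHom_apply,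
      ← Polynomial.comp_eq_aeval] at h3
    have h4 := congrArg Polynomial.natDegree h3
    rw [Polynomial.natDegree_X, Polynomial.natDegree_comp] at h4
    exact Nat.eq_one_of_mul_eq_one_right h4.symm
  obtain ⟨a, ha, b, rfl⟩ := Polynomial.natDegree_eq_one.1 h2
  refine ⟨a⁻¹, -(a⁻¹ * b), inv_ne_zero ha, ?_⟩
  rw [h1]
  have h3 : (C a⁻¹ * C a : MvPolynomial (Fin 2) K) = 1 := by
    rw [← C_mul, inv_mul_cancel₀ ha, C_1]
  simp only [map_add, map_mul, Polynomial.aeval_C, Polynomial.aeval_X, algebraMap_eq, map_neg]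
  linear_combination (-h) * h3

/-! ### Elementary automorphisms -/

section Elementary

variable {R : Type*} [CommRing R]

/-- The endomorphism `x_i ↦ x_i + c x_j ^ d` that fixes the other variable. -/
noncomputable def elementaryHom (i j : Fin 2) (c : R) (d : ℕ) :
    MvPolynomial (Fin 2) R →ₐ[R] MvPolynomial (Fin 2) R :=
  aeval (Function.update X i (X i + C c * X j ^ d))

theorem elementaryHom_X_self (i j : Fin 2) (c : R) (d : ℕ) :
    elementaryHom i j c d (X i) = X i + C c * X j ^ d := by
  simp [elementaryHom]

theorem elementaryHom_X_of_ne {i l : Fin 2} (j : Fin 2) (hl : l ≠ i) (c : R) (d : ℕ) :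
    elementaryHom i j c d (X l) = X l := by
  simp [elementaryHom, hl]

theorem elementaryHom_comp_neg {i j : Fin 2} (hij : i ≠ j) (c : R) (d : ℕ) :
    (elementaryHom i j c d).comp (elementaryHom i j (-c) d) = AlgHom.id R _ := by
  refine MvPolynomial.algHom_ext fun l => ?_
  by_cases hl : l = i
  · subst hl
    rw [AlgHom.comp_apply, elementaryHom_X_self, map_add, map_mul, map_pow,
      elementaryHom_X_self, elementaryHom_X_of_ne j hij.symm, algHom_C, algebraMap_eq, C_neg]
    simp
  · rw [AlgHom.comp_apply, elementaryHom_X_of_ne j hl, elementaryHom_X_of_ne j hl]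
    rfl

/-- The automorphism `x_i ↦ x_i + c x_j ^ d`, where `i ≠ j`. -/
noncomputable def elementaryEquiv {i j : Fin 2} (hij : i ≠ j) (c : R) (d : ℕ) :
    MvPolynomial (Fin 2) R ≃ₐ[R] MvPolynomial (Fin 2) R :=
  AlgEquiv.ofAlgHom (elementaryHom i j c d) (elementaryHom i j (-c) d)
    (elementaryHom_comp_neg hij c d)
    (by simpa using elementaryHom_comp_neg hij (-c) d)

theorem elementaryEquiv_apply {i j : Fin 2} (hij : i ≠ j) (c : R) (d : ℕ)
    (f : MvPolynomial (Fin 2) R) : elementaryEquiv hij c d f = elementaryHom i j c d f := rfl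

theorem map_elementaryHom {S : Type*} [CommRing S] (ρ : R →+* S) (i j : Fin 2) (c : R) (d : ℕ)
    (f : MvPolynomial (Fin 2) R) :
    map ρ (elementaryHom i j c d f) = elementaryHom i j (ρ c) d (map ρ f) := by
  induction f using MvPolynomial.induction_on with
  | C a => simp
  | add f g hf hg => simp only [map_add, hf, hg]
  | mul_X f l hf =>
    rw [map_mul, map_mul, hf, map_mul, map_mul, map_X]
    congr 1
    by_cases hl : l = i
    · subst hl
      rw [elementaryHom_X_self, elementaryHom_X_self]; simp
    · rw [elementaryHom_X_of_ne j hl, elementaryHom_X_of_ne j hl, map_X]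

/-- Under `ha` the torus element scales `x_i` and `x_j ^ d` by the same factor. -/
theorem diagonal_elementaryHom {a : Fin 2 → R} {i j : Fin 2} (hij : i ≠ j) {d : ℕ}
    (ha : a i = a j ^ d) (c : R) (f : MvPolynomial (Fin 2) R) :
    diagonal a (elementaryHom i j c d f) = elementaryHom i j c d (diagonal a f) := by
  refine DFunLike.congr_fun (f := (diagonal a).comp (elementaryHom i j c d))
    (g := (elementaryHom i j c d).comp (diagonal a)) (MvPolynomial.algHom_ext fun l => ?_) f
  rw [AlgHom.comp_apply, AlgHom.comp_apply, diagonal_X, map_mul]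
  by_cases hl : l = i
  · subst hl
    rw [elementaryHom_X_self, map_add, map_mul, map_pow, diagonal_X, diagonal_X, algHom_C,
      algHom_C, algebraMap_eq, ha, C_pow]
    ring
  · rw [elementaryHom_X_of_ne j hl, diagonal_X, algHom_C, algebraMap_eq]

theorem jacobianDet_elementaryHom {i j : Fin 2} (hij : i ≠ j) (c : R) (d : ℕ) :
    jacobianDet (fun l => elementaryHom i j c d (X l)) = 1 := by
  have h : ∀ l : Fin 2, elementaryHom i j c d (X l) =
      Function.update X i (X i + C c * X j ^ d) l := fun l => by simp [elementaryHom]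
  simp only [h]
  rw [jacobianDet, Matrix.det_fin_two]
  have h01 : pderiv (0 : Fin 2) (X 1 : MvPolynomial (Fin 2) R) = 0 := pderiv_X_of_ne (by decide)
  have h10 : pderiv (1 : Fin 2) (X 0 : MvPolynomial (Fin 2) R) = 0 := pderiv_X_of_ne (by decide)
  fin_cases i <;> fin_cases j
  · exact absurd rfl hij
  · simp [h01, h10]
  · simp [h01, h10]
  · exact absurd rfl hij

/-- This is the chain rule, as multiplicativity of determinants. -/
theorem jacobianDet_algHom (E : MvPolynomial (Fin 2) R →ₐ[R] MvPolynomial (Fin 2) R)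
    (f : Fin 2 → MvPolynomial (Fin 2) R) :
    jacobianDet (fun l => E (f l)) = E (jacobianDet f) * jacobianDet (fun l => E (X l)) := by
  have hE : ∀ g, E g = aeval (fun l => E (X l)) g := fun g => by
    conv_lhs => rw [← aeval_X_left_apply (p := g), MvPolynomial.comp_aeval_apply]
  rw [jacobianDet, jacobianDet, jacobianDet, AlgHom.map_det, ← Matrix.det_mul]
  congr 1
  ext1 i j
  rw [Matrix.mul_apply]
  simp only [Matrix.of_apply, AlgHom.mapMatrix_apply, Matrix.map_apply]
  rw [hE (f i), pderiv_aeval]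
  exact Finset.sum_congr rfl fun l _ => by rw [← hE]

end Elementary

/-! ### The grading by `ℤ² / M_Γ` -/

section Graded

variable {k : Type*} [Field k] (Γ : Subgroup (Fin 2 → kˣ)) {R : Type*} [CommRing R]

theorem C_mem_gradedPart (c : R) : C c ∈ gradedPart Γ R 0 := by
  have h : C c = c • (monomial 0 1 : MvPolynomial (Fin 2) R) := by
    rw [smul_monomial, smul_eq_mul, mul_one]; rfl
  rw [h]
  exact Submodule.smul_mem _ _ (Submodule.subset_span ⟨0, QuotientAddGroup.mk_zero _, rfl⟩)

theorem X_mem_gradedPart (i : Fin 2) : X i ∈ gradedPart Γ R (gen Γ i) := by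
  refine Submodule.subset_span ⟨Finsupp.single i 1, ?_, rfl⟩
  rw [gen]
  congr 1
  ext j
  rw [Finsupp.single_apply, Pi.single_apply]
  split_ifs <;> simp_all

variable {Γ}

theorem mul_mem_gradedPart {γ δ : GradingGroup Γ} {f g : MvPolynomial (Fin 2) R}
    (hf : f ∈ gradedPart Γ R γ) (hg : g ∈ gradedPart Γ R δ) :
    f * g ∈ gradedPart Γ R (γ + δ) := by
  have h := Submodule.mul_mem_mul hf hg
  rw [gradedPart, gradedPart, Submodule.span_mul_span] at h
  refine Submodule.span_mono ?_ h
  rintro _ ⟨_, ⟨d, rfl, rfl⟩, _, ⟨e, rfl, rfl⟩, rfl⟩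
  refine ⟨d + e, ?_, by simp [monomial_mul]⟩
  rw [← QuotientAddGroup.mk_add]
  congr 1

theorem pow_mem_gradedPart {γ : GradingGroup Γ} {f : MvPolynomial (Fin 2) R}
    (hf : f ∈ gradedPart Γ R γ) (n : ℕ) : f ^ n ∈ gradedPart Γ R (n • γ) := by
  induction n with
  | zero => simpa using C_mem_gradedPart Γ (1 : R)
  | succ n ih => rw [pow_succ, succ_nsmul]; exact mul_mem_gradedPart ih hf

/-- An endomorphism that respects the degrees of the variables respects the grading. -/
theorem algHom_mem_gradedPart {E : MvPolynomial (Fin 2) R →ₐ[R] MvPolynomial (Fin 2) R}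
    (hE : ∀ i, E (X i) ∈ gradedPart Γ R (gen Γ i)) {γ : GradingGroup Γ}
    {f : MvPolynomial (Fin 2) R} (hf : f ∈ gradedPart Γ R γ) : E f ∈ gradedPart Γ R γ := by
  have h : gradedPart Γ R γ ≤ (gradedPart Γ R γ).comap E.toLinearMap := by
    refine Submodule.span_le.2 ?_
    rintro _ ⟨d, rfl, rfl⟩
    change E (monomial d 1) ∈ gradedPart Γ R _
    have h1 : (monomial d 1 : MvPolynomial (Fin 2) R) = X 0 ^ d 0 * X 1 ^ d 1 := by
      rw [monomial_eq, Finsupp.prod_fintype _ _ (by simp), Fin.prod_univ_two]; simp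
    have h2 : (QuotientAddGroup.mk (fun j => (d j : ℤ)) : GradingGroup Γ) =
        d 0 • gen Γ 0 + d 1 • gen Γ 1 := by
      rw [gen, gen, ← QuotientAddGroup.mk_nsmul, ← QuotientAddGroup.mk_nsmul,
        ← QuotientAddGroup.mk_add]
      congr 1
      ext j
      fin_cases j <;> simp
    rw [h1, h2, map_mul, map_pow, map_pow]
    exact mul_mem_gradedPart (pow_mem_gradedPart (hE 0) _) (pow_mem_gradedPart (hE 1) _)
  exact h hf

/-- The hypothesis puts `e_i - d e_j` in the relation lattice; it translates torus equivariance back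
into degrees. -/
theorem gen_eq_nsmul {i j : Fin 2} {d : ℕ} (h : ∀ a ∈ Γ, a i = a j ^ d) :
    gen Γ i = d • gen Γ j := by
  rw [gen, gen, ← QuotientAddGroup.mk_nsmul, QuotientAddGroup.eq]
  intro a ha
  have h1 : ∀ l : Fin 2, multiPow a (Pi.single l 1) = a l := by
    intro l
    rw [multiPow, Fin.prod_univ_two]
    fin_cases l <;> simp
  have h2 : multiPow a (-Pi.single i 1 + d • Pi.single j 1) =
      (multiPow a (Pi.single i 1))⁻¹ * multiPow a (Pi.single j 1) ^ d := by
    simp only [multiPow, Fin.prod_univ_two, Pi.add_apply, Pi.neg_apply, Pi.smul_apply, zpow_add,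
      zpow_neg, mul_pow, mul_inv]
    simp only [nsmul_eq_mul]
    rw [mul_comm (d : ℤ), mul_comm (d : ℤ), zpow_mul, zpow_mul, zpow_natCast, zpow_natCast]
    exact mul_mul_mul_comm _ _ _ _
  rw [h2, h1, h1, h a ha, inv_mul_cancel]

theorem elementaryHom_mem_gradedPart {i j : Fin 2} {d : ℕ} (h : ∀ a ∈ Γ, a i = a j ^ d) (c : R)
    (l : Fin 2) : elementaryHom i j c d (X l) ∈ gradedPart Γ R (gen Γ l) := by
  by_cases hl : l = i
  · subst hl
    rw [elementaryHom_X_self]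
    refine Submodule.add_mem _ (X_mem_gradedPart Γ l) ?_
    rw [gen_eq_nsmul h, ← zero_add (d • gen Γ j)]
    exact mul_mem_gradedPart (C_mem_gradedPart Γ c) (pow_mem_gradedPart (X_mem_gradedPart Γ j) d)
  · rw [elementaryHom_X_of_ne j hl]
    exact X_mem_gradedPart Γ l

/-- `Γ`-homogeneous polynomials are semi-invariants of `Γ`. -/
theorem IsHomogeneousPoly.exists_diagonal_eq {K : Type*} [Field K] (ι : k →+* K)
    {f : MvPolynomial (Fin 2) K} (hf : IsHomogeneousPoly Γ f) {a : Fin 2 → kˣ} (ha : a ∈ Γ) :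
    ∃ χ : K, χ ≠ 0 ∧ diagonal (fun i => ι (a i)) f = C χ * f := by
  obtain ⟨γ, hγ⟩ := hf
  obtain ⟨v, rfl⟩ := QuotientAddGroup.mk_surjective γ
  -- The eigenvalue is the character of any representative `v` of the degree; on `Γ` it depends only
  -- on the class modulo `M_Γ`.
  refine ⟨ι (multiPow a v : kˣ), (map_ne_zero ι).2 (Units.ne_zero _), ?_⟩
  have h : gradedPart Γ K (QuotientAddGroup.mk v) ≤
      LinearMap.eqLocus (diagonal fun i => ι (a i)).toLinearMap
        (LinearMap.mulLeft K (C (ι (multiPow a v : kˣ)))) := by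
    refine Submodule.span_le.2 ?_
    rintro _ ⟨d, hd, rfl⟩
    change diagonal (fun i => ι (a i)) (monomial d 1) = C _ * monomial d 1
    have h1 : multiPow a v = a 0 ^ d 0 * a 1 ^ d 1 := by
      rw [QuotientAddGroup.eq] at hd
      have h2 : multiPow a (-(fun j => (d j : ℤ)) + v) = 1 := hd a ha
      simp only [multiPow, Fin.prod_univ_two, Pi.add_apply, Pi.neg_apply, zpow_add,
        zpow_neg, zpow_natCast] at h2 ⊢
      rw [mul_mul_mul_comm, ← mul_inv, inv_mul_eq_one] at h2
      exact h2.symm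
    have h3 : (monomial d 1 : MvPolynomial (Fin 2) K) = X 0 ^ d 0 * X 1 ^ d 1 := by
      rw [monomial_eq, Finsupp.prod_fintype _ _ (by simp), Fin.prod_univ_two]; simp
    rw [h1, h3]
    simp only [map_mul, map_pow, diagonal_X, Units.val_mul, Units.val_pow_eq_pow_val]
    ring
  exact h hγ

end Graded

/-! ### Lifting to `R` -/

/-- `h` is, up to a constant factor, the reduction of a component of a `Γ`-homogeneous automorphism
of Jacobian determinant `1`. -/
def LiftsToHomogeneousAut {k : Type*} [Field k] (Γ : Subgroup (Fin 2 → kˣ))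
    {R : Type*} [CommRing R] (p : Ideal R) (h : MvPolynomial (Fin 2) (R ⧸ p)) : Prop :=
  ∃ φ ∈ homogeneousAut Γ R, ∃ (a : (R ⧸ p)ˣ) (i : Fin 2),
    jacobianDet (fun j => φ (X j)) = 1 ∧
    h = C (a : R ⧸ p) * map (Ideal.Quotient.mk p) (φ (X i))

section Lift

variable {k : Type*} [Field k] {Γ : Subgroup (Fin 2 → kˣ)} {R : Type*} [CommRing R] {p : Ideal R}

theorem liftsToHomogeneousAut_C_mul_X (a : (R ⧸ p)ˣ) (i : Fin 2) :
    LiftsToHomogeneousAut Γ p (C (a : R ⧸ p) * X i) := by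
  refine ⟨AlgEquiv.refl, fun l => X_mem_gradedPart Γ l, a, i, ?_, by simp⟩
  have := jacobianDet_elementaryHom (show (0 : Fin 2) ≠ 1 by decide) (0 : R) 0
  rw [← this]
  congr 1
  funext l
  by_cases hl : l = 0
  · subst hl; rw [elementaryHom_X_self]; simp
  · rw [elementaryHom_X_of_ne _ hl]; rfl

/-- Any lift of `c` to `R` works: neither the homogeneity nor the Jacobian determinant of an
elementary automorphism depends on its coefficient. -/
theorem LiftsToHomogeneousAut.elementaryHom {h : MvPolynomial (Fin 2) (R ⧸ p)}
    (hh : LiftsToHomogeneousAut Γ p h) {i j : Fin 2} (hij : i ≠ j) {d : ℕ}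
    (hΓ : ∀ a ∈ Γ, a i = a j ^ d) (c : R ⧸ p) :
    LiftsToHomogeneousAut Γ p (elementaryHom i j c d h) := by
  obtain ⟨φ, hφ, a, l, hJ, rfl⟩ := hh
  obtain ⟨c, rfl⟩ := Ideal.Quotient.mk_surjective c
  refine ⟨φ.trans (elementaryEquiv hij c d), fun s => ?_, a, l, ?_, ?_⟩
  · exact algHom_mem_gradedPart (elementaryHom_mem_gradedPart hΓ c) (hφ s)
  · change jacobianDet (fun s => HomogeneousCoordinate.elementaryHom i j c d (φ (X s))) = 1
    rw [jacobianDet_algHom, hJ, jacobianDet_elementaryHom hij, map_one, one_mul]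
  · rw [map_mul, algHom_C, algebraMap_eq, AlgEquiv.trans_apply, elementaryEquiv_apply,
      map_elementaryHom]

end Lift

/-! ### Descent and conclusion -/

/-- Induction on the degrees of `x` and `y` as polynomials over `K[h]`: every property of
`Γ`-semi-invariant coordinates that holds for affine functions of a variable and is preserved by
homogeneous elementary automorphisms holds in general. -/
theorem coordinate_induction {K : Type*} [Field K] {S : Set (Fin 2 → K)}
    (hS : ∀ a ∈ S, ∀ i, a i ≠ 0) {T : MvPolynomial (Fin 2) K → Prop}
    (hX : ∀ (c : K) (i : Fin 2), c ≠ 0 → T (C c * X i))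
    (hE : ∀ f, T f → ∀ i j : Fin 2, i ≠ j → ∀ (d : ℕ) (c : K), (∀ a ∈ S, a i = a j ^ d) →
      T (elementaryHom i j c d f))
    (α : MvPolynomial (Fin 2) K ≃ₐ[K] Polynomial (Polynomial K))
    (hα : ∀ a ∈ S, ∃ χ : K, χ ≠ 0 ∧ diagonal a (α.symm (Polynomial.C Polynomial.X)) =
      C χ * α.symm (Polynomial.C Polynomial.X)) :
    T (α.symm (Polynomial.C Polynomial.X)) := by
  induction hN : (α (X 0)).natDegree + (α (X 1)).natDegree using Nat.strong_induction_on
    generalizing α with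
  | _ N ih =>
  by_cases h0 : ∃ j, (α (X j)).natDegree = 0
  · obtain ⟨j, hj⟩ := h0
    obtain ⟨b, c, hb, hbc⟩ := exists_eq_of_natDegree_eq_zero α hj
    rw [hbc] at hα ⊢
    by_cases hc : c = 0
    · rw [hc, C_0, add_zero]; exact hX b j hb
    -- A nonzero constant term is an elementary step with `d = 0`. It forces `χ = 1`, and comparing
    -- the coefficients of `X j` then gives `a j = 1`, which is the condition required of that step.
    · obtain ⟨l, hl⟩ := exists_ne j
      have h1 : elementaryHom j l (b⁻¹ * c) 0 (C b * X j) = C b * X j + C c := by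
        rw [map_mul, algHom_C, algebraMap_eq, elementaryHom_X_self, pow_zero, mul_one, mul_add,
          ← C_mul, mul_inv_cancel_left₀ hb]
      rw [← h1]
      refine hE _ (hX b j hb) j l hl.symm 0 _ fun a ha => ?_
      obtain ⟨χ, -, hχ⟩ := hα a ha
      rw [map_add, map_mul, diagonal_X, algHom_C, algHom_C, algebraMap_eq] at hχ
      have h2 := congrArg (coeff 0) hχ
      have h3 := congrArg (coeff (Finsupp.single j 1)) hχ
      have h4 : (0 : Fin 2 →₀ ℕ) ≠ Finsupp.single j 1 := by simp [eq_comm]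
      simp only [coeff_add, coeff_C_mul, coeff_zero_X, coeff_zero_C, mul_zero, zero_add] at h2
      simp only [coeff_add, coeff_C_mul, coeff_X, coeff_C, if_neg h4, if_true, mul_one,
        add_zero] at h3
      have h5 : χ = 1 := mul_right_cancel₀ hc (by rw [← h2, one_mul])
      rw [h5, one_mul] at h3
      rw [pow_zero]
      exact mul_left_cancel₀ hb (by rw [h3, mul_one])
  · push Not at h0
    obtain ⟨i, j, hij, d, c, hdeg, hlt⟩ := exists_natDegree_sub_lt α
      (Nat.pos_of_ne_zero (h0 0)) (Nat.pos_of_ne_zero (h0 1))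
    have hS' : ∀ a ∈ S, a i = a j ^ d := fun a ha => by
      obtain ⟨χ, hχ0, hχ⟩ := hα a ha
      exact eq_pow_of_diagonal_eq α (hS a ha) hχ0 hχ hdeg hlt
    -- Composing with `E` replaces `α (X i)` by the remainder of the division step and `h` by its
    -- preimage under `E`, which is again semi-invariant because `E` is equivariant.
    let E := elementaryEquiv hij (-c) d
    have hsymm : (E.trans α).symm (Polynomial.C Polynomial.X) =
        elementaryHom i j c d (α.symm (Polynomial.C Polynomial.X)) := by
      rw [← neg_neg c]; rfl
    have hback : α.symm (Polynomial.C Polynomial.X) =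
        elementaryHom i j (-c) d ((E.trans α).symm (Polynomial.C Polynomial.X)) :=
      (E.apply_symm_apply _).symm
    have hi : (E.trans α) (X i) = α (X i) - Polynomial.C (Polynomial.C c) * α (X j) ^ d := by
      rw [AlgEquiv.trans_apply, elementaryEquiv_apply, elementaryHom_X_self, map_add, map_mul,
        map_pow, algEquiv_C]
      simp only [Polynomial.C_neg]
      ring
    have hj : (E.trans α) (X j) = α (X j) := by
      rw [AlgEquiv.trans_apply, elementaryEquiv_apply, elementaryHom_X_of_ne j hij.symm]
    have hsum : ∀ g : Fin 2 → ℕ, g 0 + g 1 = g i + g j := by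
      intro g
      fin_cases i <;> fin_cases j
      · exact absurd rfl hij
      · rfl
      · exact add_comm _ _
      · exact absurd rfl hij
    rw [hback]
    refine hE _ (ih _ ?_ (E.trans α) (fun a ha => ?_) rfl) i j hij d (-c) hS'
    · rw [← hN, hsum fun l => (α (X l)).natDegree, hsum fun l => ((E.trans α) (X l)).natDegree,
        hi, hj]
      exact Nat.add_lt_add_right hlt _
    · obtain ⟨χ, hχ0, hχ⟩ := hα a ha
      refine ⟨χ, hχ0, ?_⟩
      rw [hsymm, diagonal_elementaryHom hij (hS' a ha), hχ, map_mul, algHom_C, algebraMap_eq]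

end HomogeneousCoordinate

theorem mainTheorem7 {k : Type*} [Field k] (Γ : Subgroup (Fin 2 → kˣ)) (hΓ : Γ ≠ ⊥)
    {R : Type*} [CommRing R] [Algebra k R] (p : Ideal R) (hp : p.IsMaximal)
    (h : MvPolynomial (Fin 2) (R ⧸ p))
    (hcoord : HomogeneousCoordinate.IsCoordinate h)
    (hhom : HomogeneousCoordinate.IsHomogeneousPoly Γ h) :
    ∃ φ ∈ HomogeneousCoordinate.homogeneousAut Γ R,
      ∃ (a : (R ⧸ p)ˣ) (i : Fin 2),
        HomogeneousCoordinate.jacobianDet (fun j => φ (MvPolynomial.X j)) = 1 ∧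
        h = MvPolynomial.C (a : R ⧸ p) *
          MvPolynomial.map (Ideal.Quotient.mk p) (φ (MvPolynomial.X i)) := by
  open HomogeneousCoordinate in
  let _ : Field (R ⧸ p) := Ideal.Quotient.field p
  let ι : k →+* R ⧸ p := (Ideal.Quotient.mk p).comp (algebraMap k R)
  obtain ⟨α, rfl⟩ := hcoord.exists_algEquiv
  change LiftsToHomogeneousAut Γ p _
  refine coordinate_induction (S := (fun a i => ι (a i : kˣ)) '' (Γ : Set (Fin 2 → kˣ)))
    ?_ (fun c i hc => ?_) (fun f hf i j hij d c hd => ?_) α ?_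
  · rintro _ ⟨a, -, rfl⟩ i
    exact (map_ne_zero ι).2 (Units.ne_zero _)
  · exact liftsToHomogeneousAut_C_mul_X (Units.mk0 c hc) i
  -- Relations among the images of `Γ` in the residue field already hold in `k`, as `ι` is
  -- injective.
  · refine hf.elementaryHom hij (fun a ha => Units.ext (ι.injective ?_)) c
    have h1 := hd _ ⟨a, ha, rfl⟩
    rw [Units.val_pow_eq_pow_val, map_pow]
    exact h1
  · rintro _ ⟨a, ha, rfl⟩
    exact hhom.exists_diagonal_eq ι ha
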